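/- A market with $n$ agents consists of a finite set $M$ of $m$ items and, for each agent $i\in[n]$, a valuation $v_i:2^M\to\mathbb{Q}_{\ge 0}$ that is normalized ($v_i(\emptyset)=0$) and monotone ($X\subseteq Y$ implies $v_i(X)\le v_i(Y)$). A valuation $v$ is $k$-demand if $v(X)=\max\{v(X') : X'\subseteq X,\ |X'|\le k\}$ for every $X\subseteq M$. An allocation is a partition $S=(S_0,S_1,\dots,S_n)$ of $M$ into $n+1$ disjoint, possibly empty, bundles, where agent $i\in[n]$ gets $S_i$ and $S_0$ stays unallocated; it is optimal if it maximizes the social welfare $\sum_{i\in[n]}v_i(S_i)$ over all allocations. The search problem WinnerDetermination asks, given a market, for an optimal allocation. A market with $k$-demand valuations is given as a string by listing its items and, for each agent, all bundles of at most $k$ items (each as its characteristic bit string of length $m$) together with their values, each value being written as numerator and denominator in lowest terms, in binary; an allocation is given as a string by listing the characteristic bit strings of $S_0,S_1,\dots,S_n$. Theorem. Let $k\ge 0$ and $n\ge 0$ be constants. On markets with $n$ agents that all have $k$-demand valuations, WinnerDetermination is solvable in polynomial time: there is a multi-tape Turing machine that, given such a market, outputs an optimal allocation in a number of steps that is polynomial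 in the length of the input string. Moreover, this length is at most $c\,(m+1)^{k+1}(b+1)$, where $b$ is the largest number of symbols used to write a value of the market and $c$ depends only on $k$ and $n$; hence the running time is polynomial in $m$ and $b$. -/

import Mathlib

namespace KDemand

open Computability

/-- A market with `n` agents: a finite set of items, and for each agent a normalized monotone
valuation of the bundles of items. The values are nonnegative rationals, so that a market can be
written down as a finite string. -/
structure Market (n : ℕ) where
  /-- the number `m` of items; the set of items is `Fin m` -/
  numItems : ℕ
  /-- the value of a bundle for an agent -/
  val : Fin n → Finset (Fin numItems) → NNRat
  normalized : ∀ i, val i ∅ = 0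
  monotone : ∀ i, Monotone (val i)

/-- A valuation `v` is `k`-demand if `v X` is the maximum of the values of the subsets of `X`
with at most `k` elements, for every bundle `X`. -/
def IsKDemand {m : ℕ} (k : ℕ) (v : Finset (Fin m) → NNRat) : Prop :=
  ∀ X : Finset (Fin m), IsGreatest (v '' {Y | Y ⊆ X ∧ Y.card ≤ k}) (v X)

/-- Markets with `n` agents, all of whose valuations are `k`-demand. -/
def KDemandMarket (k n : ℕ) : Type :=
  {M : Market n // ∀ i, IsKDemand k (M.val i)}

/-- An allocation: a partition `(S 0, S 1, …, S n)` of the items into `n + 1` disjoint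
(possibly empty) bundles. The items in `S 0` stay unallocated, and `S i.succ` is given to
agent `i : Fin n`. -/
structure Allocation (n m : ℕ) where
  bundle : Fin (n + 1) → Finset (Fin m)
  disjoint : ∀ i j, i ≠ j → Disjoint (bundle i) (bundle j)
  covers : ∀ a : Fin m, ∃ i, a ∈ bundle i

/-- The social welfare of an allocation. -/
def Market.socialWelfare {n : ℕ} (M : Market n) (S : Allocation n M.numItems) : NNRat :=
  ∑ i : Fin n, M.val i (S.bundle i.succ)

/-- An allocation is optimal if it maximizes the social welfare over all allocations. -/
def Market.IsOptimal {n : ℕ} (M : Market n) (S : Allocation n M.numItems) : Prop :=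
  ∀ T : Allocation n M.numItems, M.socialWelfare T ≤ M.socialWelfare S

/-- The finite alphabet of inputs and outputs: blank, the bits `0` and `1`, two brackets and a
comma. -/
abbrev Symb : Type := Γ'

/-- A bundle, written as its characteristic bit string of length `m`. -/
def encodeBundle {m : ℕ} (X : Finset (Fin m)) : List Symb :=
  (List.finRange m).map fun j => Γ'.bit (decide (j ∈ X))

/-- A nonnegative rational, written as its numerator and denominator in lowest terms, both in
binary. -/
def encodeValue (q : NNRat) : List Symb :=
  encodingNatΓ'.encode q.num ++ Γ'.comma :: encodingNatΓ'.encode q.den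

/-- The list of all bundles with at most `k` items. -/
def smallBundles (k m : ℕ) : List (Finset (Fin m)) :=
  ((List.finRange m).sublists.filter fun l => l.length ≤ k).map List.toFinset

/-- A `k`-demand valuation, written as the table that lists every bundle with at most `k` items
together with its value. -/
def encodeValuation {m : ℕ} (k : ℕ) (v : Finset (Fin m) → NNRat) : List Symb :=
  Γ'.bra :: ((smallBundles k m).flatMap fun X =>
    Γ'.bra :: encodeBundle X ++ Γ'.comma :: encodeValue (v X) ++ [Γ'.ket]) ++ [Γ'.ket]

/-- A market with `k`-demand valuations, written as a list of the items (one mark for each) and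
the tables of the `n` valuations. -/
def encodeMarket {k n : ℕ} (M : KDemandMarket k n) : List Symb :=
  List.replicate M.1.numItems (Γ'.bit true) ++ Γ'.comma ::
    (List.finRange n).flatMap fun i => encodeValuation k (M.1.val i)

/-- An allocation, written as the list of its bundles `S 0, S 1, …, S n`. -/
def encodeAllocation {n m : ℕ} (S : Allocation n m) : List Symb :=
  (List.finRange (n + 1)).flatMap fun i => Γ'.bra :: encodeBundle (S.bundle i) ++ [Γ'.ket]

/-- A search problem is given by its instances `I`, written as strings by `enc`, and by the
strings that are solutions of an instance. It is solvable in polynomial time if some Turing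
machine (a multi-stack machine, with the stacks as its tapes) outputs a solution of every
instance `x` within a number of steps that is polynomial in the length of `enc x`. -/
def SolvableInPolyTime {I Γ Δ : Type} (enc : I → List Γ) (IsSolution : I → List Δ → Prop) : Prop :=
  ∃ f : I → List Δ, Nonempty (Turing.TM2ComputableInPolyTime enc (id : List Δ → List Δ) f) ∧
    ∀ x, IsSolution x (f x)

/-- The search problem of winner determination: a solution for a market is (the string of) an
optimal allocation of its items. -/
def WinnerDetermination {k n : ℕ} (M : KDemandMarket k n) (s : List Symb) : Prop :=
  ∃ S : Allocation n M.1.numItems, M.1.IsOptimal S ∧ s = encodeAllocation S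

/-- The largest number of symbols that a value of the market takes when it is written down. -/
def Market.valueSize {n : ℕ} (M : Market n) : ℕ :=
  Finset.univ.sup fun p : Fin n × Finset (Fin M.numItems) => (encodeValue (M.val p.1 p.2)).length

end KDemand

/-!
Since the valuations are `k`-demand, shrinking the bundles of an allocation to subsets with at most
`k` items that have the same value, and leaving the other items unallocated, does not change the
social welfare. So an optimal allocation is found among those in which every agent gets one of the
bundles listed in its table. There are at most `(m + 1) ^ k` bundles in each of the `n` tables, so
that all `n`-tuples of pairwise disjoint bundles can be tried, comparing their total values as
fractions in binary. `search` does this by `n` nested loops over the tables, and `search_spec` is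
its correctness. The bound on the length of the input follows from the number of listed bundles
(`length_smallBundles_le`).

The time bound comes from a small theory of polynomial-time computation. A `Prog` is a structured
program that works on finitely many stacks, with sequencing, branching on a top symbol and
while-loops; its positions serve as the labels of a Turing machine that simulates it step by step
(`Runs.simulate`, `Prog.tm2ComputableInPolyTime`). A function is `PolyTime` if such a program
computes it in polynomially many steps, where elements of a product type are kept in disjoint sets
of registers. This class is closed under composition, pairing, case distinction, and, above all,
folding over a string, provided that the intermediate values have polynomial size
(`PolyTime.foldl`). In the form used most, `PolyTime.foldl₂`, each step enlarges the value by an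
amount that does not depend on the value itself. It applies to the search because the state of a
loop is the best candidate found so far: a step either keeps it or replaces it by one whose size is
bounded in terms of the input only. As `n` is a constant, nesting the loops composes polynomials a
constant number of times. Polynomiality of `search n` is therefore proved by induction on `n`.
-/

namespace KDemand

open Computability Function

/-! ### A language of register programs -/

/-- The content of registers indexed by `R`: each register holds a string, used as a stack. -/
abbrev Store (R : Type) : Type := R → List Symb

/-- Programs of a structured language for stacks, which `Prog.machine` turns into Turing
machines. A `case` branches on the top symbol of a register without removing it, and
`loop r p` runs `p` as long as the register `r` is nonempty. -/
inductive Prog (R : Type) : Type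
  | nop
  | push (r : R) (a : Symb)
  | pop (r : R)
  | seq (p q : Prog R)
  | case (r : R) (f : Option Symb → Prog R)
  | loop (r : R) (p : Prog R)

/-- `Runs p S S' t`: started on the store `S`, the program `p` terminates with the store `S'`
after `t` steps. -/
inductive Runs {R : Type} [DecidableEq R] : Prog R → Store R → Store R → ℕ → Prop
  | nop (S) : Runs .nop S S 1
  | push (r a S) : Runs (.push r a) S (update S r (a :: S r)) 1
  | pop (r S) : Runs (.pop r) S (update S r (S r).tail) 1
  | seq {p q S S₁ S₂ t₁ t₂} : Runs p S S₁ t₁ → Runs q S₁ S₂ t₂ → Runs (.seq p q) S S₂ (t₁ + t₂)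
  | case {r f S S' t} : Runs (f (S r).head?) S S' t → Runs (.case r f) S S' (t + 1)
  | loop_done {r p S} : S r = [] → Runs (.loop r p) S S 1
  | loop_step {r p S S₁ S₂ t₁ t₂} : S r ≠ [] → Runs p S S₁ t₁ → Runs (.loop r p) S₁ S₂ t₂ →
      Runs (.loop r p) S S₂ (t₁ + t₂ + 1)

/-! ### Compilation to Turing machines -/

namespace Prog

variable {R : Type}

/-- The positions of a program, which are the labels of the machine that executes it. -/
def Label : Prog R → Type
  | nop => Unit
  | push _ _ => Unit
  | pop _ => Unit
  | seq p q => p.Label ⊕ q.Label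
  | case _ f => Unit ⊕ Σ o, (f o).Label
  | loop _ p => Unit ⊕ p.Label

/-- The position at which the execution of a program starts. -/
def entry : (p : Prog R) → p.Label
  | nop => ()
  | push _ _ => ()
  | pop _ => ()
  | seq p _ => Sum.inl p.entry
  | case _ _ => Sum.inl ()
  | loop _ _ => Sum.inl ()

/-- The positions of a program form a finite type. -/
@[reducible]
noncomputable def labelFintype : (p : Prog R) → Fintype p.Label
  | nop => inferInstanceAs (Fintype Unit)
  | push _ _ => inferInstanceAs (Fintype Unit)
  | pop _ => inferInstanceAs (Fintype Unit)
  | seq p q =>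
    letI := p.labelFintype
    letI := q.labelFintype
    inferInstanceAs (Fintype (p.Label ⊕ q.Label))
  | case _ f =>
    letI := fun o => (f o).labelFintype
    inferInstanceAs (Fintype (Unit ⊕ Σ o, (f o).Label))
  | loop _ p =>
    letI := p.labelFintype
    inferInstanceAs (Fintype (Unit ⊕ p.Label))

/-- The statement executed at a position of a program, when the positions of the program are
embedded into the labels `L` of a machine by `emb`, and the machine continues at `exit` after the
program. The internal state of the machine is the symbol it has read last. -/
def code {L : Type} : (p : Prog R) → (emb : p.Label → L) → (exit : L) → p.Label →
    Turing.TM2.Stmt (fun _ : R => Symb) L (Option Symb)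
  | nop, _, exit, _ => .goto fun _ => exit
  | push r a, _, exit, _ => .push r (fun _ => a) (.goto fun _ => exit)
  | pop r, _, exit, _ => .pop r (fun v _ => v) (.goto fun _ => exit)
  | seq p q, emb, _, Sum.inl l => p.code (fun x => emb (Sum.inl x)) (emb (Sum.inr q.entry)) l
  | seq _ q, emb, exit, Sum.inr l => q.code (fun x => emb (Sum.inr x)) exit l
  | case r f, emb, _, Sum.inl _ =>
    .peek r (fun _ o => o) (.goto fun o => emb (Sum.inr ⟨o, (f o).entry⟩))
  | case _ f, emb, exit, Sum.inr ⟨o, l⟩ => (f o).code (fun x => emb (Sum.inr ⟨o, x⟩)) exit l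
  | loop r p, emb, exit, Sum.inl _ =>
    .peek r (fun _ o => o)
      (.branch Option.isSome (.goto fun _ => emb (Sum.inr p.entry)) (.goto fun _ => exit))
  | loop _ p, emb, _, Sum.inr l => p.code (fun x => emb (Sum.inr x)) (emb (Sum.inl ())) l

end Prog

/-- Iterating the step function of a machine. -/
def stepN {C : Type} (step : C → Option C) (t : ℕ) : Option C → Option C :=
  (flip bind step)^[t]

theorem stepN_add {C : Type} {step : C → Option C} {a b c : Option C} {t u : ℕ}
    (h₁ : stepN step t a = b) (h₂ : stepN step u b = c) : stepN step (t + u) a = c := by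
  rw [← h₂, ← h₁, stepN, Nat.add_comm, Function.iterate_add_apply, stepN, stepN]

theorem stepN_one {K L σ : Type} [DecidableEq K] {Γ : K → Type}
    {M : L → Turing.TM2.Stmt Γ L σ} {l : L} {q : Turing.TM2.Stmt Γ L σ} (h : M l = q)
    (v : σ) (S : ∀ k, List (Γ k)) :
    stepN (Turing.TM2.step M) 1 (some ⟨some l, v, S⟩) = some (Turing.TM2.stepAux q v S) := by
  rw [← h]; rfl

/-- A machine that contains the code of a program simulates the program step by step. -/
theorem Runs.simulate {R L : Type} [DecidableEq R] {p : Prog R} {S S' : Store R} {t : ℕ}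
    (h : Runs p S S' t) (M : L → Turing.TM2.Stmt (fun _ : R => Symb) L (Option Symb))
    (emb : p.Label → L) (exit : L) (hM : ∀ l, M (emb l) = p.code emb exit l) (v : Option Symb) :
    ∃ v', stepN (Turing.TM2.step M) t (some ⟨some (emb p.entry), v, S⟩) =
      some ⟨some exit, v', S'⟩ := by
  induction h generalizing v exit with
  | nop S => exact ⟨v, stepN_one (hM _) v S⟩
  | push r a S => exact ⟨v, stepN_one (hM _) v S⟩
  | pop r S => exact ⟨v, stepN_one (hM _) v S⟩
  | @seq p q S S₁ S₂ t₁ t₂ _ _ ihp ihq =>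
    obtain ⟨v₁, h₁⟩ := ihp (fun x => emb (Sum.inl x)) (emb (Sum.inr q.entry))
      (fun l => hM (Sum.inl l)) v
    obtain ⟨v₂, h₂⟩ := ihq (fun x => emb (Sum.inr x)) exit (fun l => hM (Sum.inr l)) v₁
    exact ⟨v₂, stepN_add h₁ h₂⟩
  | @case r f S S' t _ ih =>
    obtain ⟨v₁, h₁⟩ := ih (fun x => emb (Sum.inr ⟨_, x⟩)) exit (fun l => hM (Sum.inr ⟨_, l⟩))
      (S r).head?
    exact ⟨v₁, Nat.add_comm t 1 ▸ stepN_add (stepN_one (hM (Sum.inl ())) v S) h₁⟩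
  | @loop_done r p S hr =>
    refine ⟨none, (stepN_one (hM (Sum.inl ())) v S).trans ?_⟩
    simp [Prog.code, hr]
  | @loop_step r p S S₁ S₂ t₁ t₂ hr _ _ ihp ihl =>
    obtain ⟨v₁, h₁⟩ := ihp (fun x => emb (Sum.inr x)) (emb (Sum.inl ()))
      (fun l => hM (Sum.inr l)) (S r).head?
    obtain ⟨v₂, h₂⟩ := ihl emb exit hM v₁
    refine ⟨v₂, Nat.add_comm (t₁ + t₂) 1 ▸
      stepN_add ((stepN_one (hM (Sum.inl ())) v S).trans ?_) (stepN_add h₁ h₂)⟩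
    obtain ⟨a, l, hl⟩ := List.exists_cons_of_ne_nil hr
    simp [Prog.code, hl]

/-- The machine that executes a program and halts, with the registers as its stacks. The label
`none` belongs to the final step, which resets the internal state. -/
noncomputable def Prog.machine {R : Type} [Fintype R] [DecidableEq R] (p : Prog R)
    (input output : R) : Turing.FinTM2 :=
  letI := p.labelFintype
  { K := R
    k₀ := input
    k₁ := output
    Γ := fun _ => Symb
    Λ := Option p.Label
    main := some p.entry
    σ := Option Symb
    initialState := none
    m := fun l => l.elim (.load (fun _ => none) .halt) (p.code some none) }

theorem initList_eq {R : Type} [Fintype R] [DecidableEq R] (p : Prog R) (i o : R) (s : List Symb) :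
    Turing.initList (p.machine i o) s =
      ⟨some (some p.entry), none, fun r : R => if r = i then s else []⟩ := by
  refine congrArg (Turing.TM2.Cfg.mk _ _) ?_
  refine funext fun (k : R) => ?_
  rcases eq_or_ne i k with h | h
  · cases h
    exact (dif_pos rfl).trans (if_pos rfl).symm
  · exact (dif_neg h.symm).trans (if_neg h.symm).symm

theorem haltList_eq {R : Type} [Fintype R] [DecidableEq R] (p : Prog R) (i o : R) (s : List Symb) :
    Turing.haltList (p.machine i o) s =
      ⟨none, none, fun r : R => if r = o then s else []⟩ := by
  refine congrArg (Turing.TM2.Cfg.mk _ _) ?_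
  refine funext fun (k : R) => ?_
  rcases eq_or_ne o k with h | h
  · cases h
    exact (dif_pos rfl).trans (if_pos rfl).symm
  · exact (dif_neg h.symm).trans (if_neg h.symm).symm

/-- A program that computes `f` in polynomial time yields a machine that does so. -/
theorem Prog.tm2ComputableInPolyTime {R I : Type} [Fintype R] [DecidableEq R] (p : Prog R)
    (i o : R) (e : I → List Symb) (f : I → List Symb) (P : Polynomial ℕ)
    (h : ∀ x, ∃ t ≤ P.eval (e x).length, Runs p (fun r => if r = i then e x else [])
      (fun r => if r = o then f x else []) t) :
    Nonempty (Turing.TM2ComputableInPolyTime e (id : List Symb → List Symb) f) := by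
  choose t ht hr using h
  refine ⟨⟨⟨p.machine i o, Equiv.refl _, Equiv.refl _⟩, P + 1, fun x => ⟨⟨t x + 1, ?_⟩, ?_⟩⟩⟩
  · obtain ⟨v, hv⟩ := (hr x).simulate (p.machine i o).m some none (fun l => rfl) none
    refine stepN_add (u := 1) ((congrArg _ (congrArg some ?_)).trans hv)
      (Eq.trans rfl (congrArg some ?_))
    · exact (congrArg (Turing.initList _) (List.map_id _)).trans (initList_eq p i o _)
    · exact ((congrArg (Turing.haltList _) (List.map_id _)).trans (haltList_eq p i o _)).symm
  · simpa using ht x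

/-! ### Basic register programs -/

/-- `RunsIn p S S' T`: started on the store `S`, the program `p` terminates with the store `S'`
after at most `T` steps. -/
def RunsIn {R : Type} [DecidableEq R] (p : Prog R) (S S' : Store R) (T : ℕ) : Prop :=
  ∃ t ≤ T, Runs p S S' t

section RunsIn

variable {R : Type} [DecidableEq R]

theorem RunsIn.mono {p : Prog R} {S S' : Store R} {T T' : ℕ} (h : RunsIn p S S' T) (hT : T ≤ T') :
    RunsIn p S S' T' :=
  let ⟨t, ht, hr⟩ := h
  ⟨t, ht.trans hT, hr⟩

theorem RunsIn.seq {p q : Prog R} {S S₁ S₂ : Store R} {T₁ T₂ : ℕ} (hp : RunsIn p S S₁ T₁)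
    (hq : RunsIn q S₁ S₂ T₂) : RunsIn (.seq p q) S S₂ (T₁ + T₂) :=
  let ⟨t₁, h₁, hr₁⟩ := hp
  let ⟨t₂, h₂, hr₂⟩ := hq
  ⟨t₁ + t₂, Nat.add_le_add h₁ h₂, hr₁.seq hr₂⟩

theorem RunsIn.case {r : R} {f : Option Symb → Prog R} {S S' : Store R} {T : ℕ} {o : Option Symb}
    (ho : (S r).head? = o) (h : RunsIn (f o) S S' T) : RunsIn (.case r f) S S' (T + 1) := by
  subst ho
  obtain ⟨t, ht, hr⟩ := h
  exact ⟨t + 1, Nat.add_le_add_right ht 1, .case hr⟩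

theorem RunsIn.loop_step {r : R} {p : Prog R} {S S₁ S₂ : Store R} {T₁ T₂ : ℕ} (hr : S r ≠ [])
    (hp : RunsIn p S S₁ T₁) (hl : RunsIn (.loop r p) S₁ S₂ T₂) :
    RunsIn (.loop r p) S S₂ (T₁ + T₂ + 1) :=
  let ⟨t₁, h₁, hr₁⟩ := hp
  let ⟨t₂, h₂, hr₂⟩ := hl
  ⟨t₁ + t₂ + 1, by lia, .loop_step hr hr₁ hr₂⟩

/-- A program prolongs a register by at most one symbol in each step. -/
theorem Runs.length_le {p : Prog R} {S S' : Store R} {t : ℕ} (h : Runs p S S' t) (x : R) :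
    (S' x).length ≤ (S x).length + t := by
  induction h with
  | nop => simp
  | push r a S =>
    by_cases hx : x = r
    · subst hx; simp
    · simp [hx]
  | pop r S =>
    by_cases hx : x = r
    · subst hx; simp; lia
    · simp [hx]
  | seq _ _ _ _ => lia
  | case _ _ => lia
  | loop_done _ => lia
  | loop_step _ _ _ _ _ => lia

/-- Removes all symbols from a register. -/
def Prog.clear (r : R) : Prog R := .loop r (.pop r)

theorem runsIn_clear (r : R) (S : Store R) :
    RunsIn (.clear r) S (update S r []) (2 * (S r).length + 1) := by
  generalize hl : S r = l
  induction l generalizing S with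
  | nil =>
    rw [← hl, update_eq_self]
    exact ⟨1, le_of_eq (by simp [hl]), .loop_done hl⟩
  | cons a l ih =>
    have h := ih (update S r (S r).tail) (by simp [hl])
    rw [update_idem] at h
    refine (RunsIn.loop_step (by simp [hl]) ⟨1, le_rfl, .pop r S⟩ h).mono ?_
    simp only [List.length_cons]; lia

/-- Removes all symbols from every register of a list. -/
def Prog.clearAll : List R → Prog R
  | [] => .nop
  | r :: rs => .seq (.clear r) (.clearAll rs)

theorem runsIn_clearAll (rs : List R) (S : Store R) (N : ℕ) (hN : ∀ r ∈ rs, (S r).length ≤ N) :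
    RunsIn (.clearAll rs) S (fun x => if x ∈ rs then [] else S x)
      (rs.length * (2 * N + 1) + 1) := by
  induction rs generalizing S with
  | nil => exact ⟨1, by simp, by simpa [Prog.clearAll] using Runs.nop S⟩
  | cons r rs ih =>
    have h := (runsIn_clear r S).seq (ih (update S r []) fun x hx => by
      by_cases hxr : x = r
      · subst hxr; simp
      · simpa [hxr] using hN x (by simp [hx]))
    have hS : (fun x => if x ∈ rs then [] else update S r [] x) =
        fun x => if x ∈ r :: rs then [] else S x := by
      funext x
      by_cases hxr : x = r
      · subst hxr; simp
      · simp [hxr]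
    rw [hS] at h
    refine h.mono ?_
    have := hN r (by simp)
    simp only [List.length_cons]
    nlinarith

/-- Pushes a symbol onto every register of a list. -/
def Prog.pushAll (a : Symb) : List R → Prog R
  | [] => .nop
  | r :: rs => .seq (.push r a) (.pushAll a rs)

theorem runs_pushAll (a : Symb) (rs : List R) (hrs : rs.Nodup) (S : Store R) :
    Runs (.pushAll a rs) S (fun x => if x ∈ rs then a :: S x else S x) (rs.length + 1) := by
  induction rs generalizing S with
  | nil => simpa [Prog.pushAll] using Runs.nop S
  | cons r rs ih =>
    obtain ⟨hr, hrs⟩ := List.nodup_cons.1 hrs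
    have h := (Runs.push r a S).seq (ih hrs _)
    have hS : (fun x => if x ∈ rs then a :: update S r (a :: S r) x
        else update S r (a :: S r) x) = fun x => if x ∈ r :: rs then a :: S x else S x := by
      funext x
      by_cases hxr : x = r
      · subst hxr; simp [hr]
      · simp [hxr]
    rwa [hS, Nat.add_comm] at h

/-- Moves the content of a register symbol by symbol onto every register of a list, which
reverses its order. -/
def Prog.transfer (r : R) (rs : List R) : Prog R :=
  .loop r (.case r fun o => .seq (.pop r) (o.elim .nop fun a => .pushAll a rs))

theorem runsIn_transfer (r : R) (rs : List R) (hrs : rs.Nodup) (hr : r ∉ rs) (S : Store R) :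
    RunsIn (.transfer r rs) S
      (fun x => if x = r then [] else if x ∈ rs then (S r).reverse ++ S x else S x)
      ((rs.length + 4) * (S r).length + 1) := by
  generalize hl : S r = l
  induction l generalizing S with
  | nil =>
    refine ⟨1, by simp, ?_⟩
    have hS : (fun x => if x = r then [] else if x ∈ rs then [].reverse ++ S x else S x) = S := by
      funext x
      by_cases hxr : x = r
      · subst hxr; simp [hl]
      · simp [hxr]
    rw [hS]
    exact .loop_done hl
  | cons a l ih =>
    have hpush : RunsIn (.pushAll a rs) _ _ _ :=
      ⟨_, le_rfl, runs_pushAll a rs hrs (update S r (S r).tail)⟩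
    have hbody : RunsIn (.case r fun o => .seq (.pop r) (o.elim .nop fun a => .pushAll a rs))
      S _ _ := RunsIn.case (o := some a) (by simp [hl])
        (RunsIn.seq ⟨1, le_rfl, .pop r S⟩ hpush)
    have h := RunsIn.loop_step (by simp [hl]) hbody (ih _ (by simp [hr, hl]))
    have hS : (fun x => if x = r then [] else if x ∈ rs then l.reverse ++
        (if x ∈ rs then a :: update S r (S r).tail x else update S r (S r).tail x)
        else if x ∈ rs then a :: update S r (S r).tail x else update S r (S r).tail x) =
        fun x => if x = r then [] else if x ∈ rs then (a :: l).reverse ++ S x else S x := by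
      funext x
      by_cases hxr : x = r
      · subst hxr; simp
      · by_cases hx : x ∈ rs <;> simp [hxr, hx]
    rw [hS] at h
    refine h.mono (le_of_eq ?_)
    simp only [List.length_cons]; ring

/-- Copies the register `r` to the empty register `d`, using the empty register `w`. -/
def Prog.copy (r d w : R) : Prog R := .seq (.transfer r [w]) (.transfer w [r, d])

theorem runsIn_copy {r d w : R} (hrd : r ≠ d) (hrw : r ≠ w) (hdw : d ≠ w) {S : Store R}
    (hd : S d = []) (hw : S w = []) :
    RunsIn (.copy r d w) S (update S d (S r)) (11 * (S r).length + 2) := by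
  have h := (runsIn_transfer r [w] (by simp) (by simpa using hrw) S).seq
    (runsIn_transfer w [r, d] (by simpa using hrd) (by simp [hrw.symm, hdw.symm]) _)
  have hS : (fun x => if x = w then [] else if x ∈ [r, d] then
        ((if w = r then [] else if w ∈ [w] then (S r).reverse ++ S w else S w) : List Symb).reverse
          ++ (if x = r then [] else if x ∈ [w] then (S r).reverse ++ S x else S x)
      else if x = r then [] else if x ∈ [w] then (S r).reverse ++ S x else S x) =
      update S d (S r) := by
    funext x
    rcases eq_or_ne x w with rfl | hxw
    · simp [hdw.symm, hw]
    rcases eq_or_ne x d with rfl | hxd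
    · simp [hdw, hd, hrd.symm, hrw.symm, hw]
    rcases eq_or_ne x r with rfl | hxr
    · simp [hrd, hrw, hrw.symm, hw]
    · simp [hxw, hxd, hxr]
  rw [hS] at h
  refine h.mono (le_of_eq ?_)
  simp [hrw.symm, hw]; ring

/-- Copies the register `src i` to the empty register `dst i` for every `i` of a list, using the
empty register `w`. -/
def Prog.copyAll {ι : Type} (src dst : ι → R) (w : R) : List ι → Prog R
  | [] => .nop
  | i :: is => .seq (.copy (src i) (dst i) w) (.copyAll src dst w is)

theorem runsIn_copyAll {ι : Type} {src dst : ι → R} {w : R} (hinj : Injective dst)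
    (hsd : ∀ i j, src i ≠ dst j) (hsw : ∀ i, src i ≠ w) (hdw : ∀ i, dst i ≠ w) (N : ℕ)
    (is : List ι) (his : is.Nodup) (S : Store R) (hw : S w = []) (hd : ∀ i ∈ is, S (dst i) = [])
    (hN : ∀ i ∈ is, (S (src i)).length ≤ N) :
    ∃ S', RunsIn (.copyAll src dst w is) S S' (is.length * (11 * N + 2) + 1) ∧
      (∀ i ∈ is, S' (dst i) = S (src i)) ∧ ∀ x, (∀ i ∈ is, x ≠ dst i) → S' x = S x := by
  induction is generalizing S with
  | nil => exact ⟨S, ⟨1, by simp, .nop S⟩, by simp, fun _ _ => rfl⟩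
  | cons i is ih =>
    obtain ⟨hi, his⟩ := List.nodup_cons.1 his
    obtain ⟨S', hr, hS', hf⟩ := ih his (update S (dst i) (S (src i)))
      (by simp [(hdw i).symm, hw])
      (fun j hj => by
        have : dst j ≠ dst i := fun h => hi (hinj h ▸ hj)
        simpa [this] using hd j (by simp [hj]))
      (fun j hj => by simpa [hsd j i] using hN j (by simp [hj]))
    refine ⟨S', ((runsIn_copy (hsd i i) (hsw i) (hdw i) (hd i (by simp)) hw).seq hr).mono ?_,
      ?_, ?_⟩
    · have := hN i (by simp)
      simp only [List.length_cons]
      nlinarith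
    · intro j hj
      rcases List.mem_cons.1 hj with rfl | hj
      · rw [hf _ fun k hk h => by cases hinj h; exact hi hk]; simp
      · rw [hS' j hj]; simp [hsd j i]
    · intro x hx
      rw [hf x fun j hj => hx j (by simp [hj])]
      simp [hx i (by simp)]

/-- Every store can be written by some program. -/
theorem exists_runsIn_write [Fintype R] (S : Store R) :
    ∃ p T, RunsIn p (fun _ => []) S T := by
  have hl : ∀ (r : R) (l : List Symb) (U : Store R),
      ∃ p T, RunsIn p U (update U r (l ++ U r)) T := by
    intro r l U
    induction l with
    | nil => exact ⟨.nop, 1, 1, le_rfl, by simpa using Runs.nop U⟩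
    | cons a l ih =>
      obtain ⟨p, T, h⟩ := ih
      refine ⟨.seq p (.push r a), T + 1, h.seq ⟨1, le_rfl, ?_⟩⟩
      convert Runs.push r a _ using 1
      simp
  have h : ∀ rs : Finset R, ∃ p T,
      RunsIn p (fun _ => []) (fun r => if r ∈ rs then S r else []) T := by
    intro rs
    induction rs using Finset.induction_on with
    | empty => exact ⟨.nop, 1, 1, le_rfl, by simpa using Runs.nop _⟩
    | insert r rs hr ih =>
      obtain ⟨p, T, h⟩ := ih
      obtain ⟨q, T', h'⟩ := hl r (S r) (fun r => if r ∈ rs then S r else [])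
      refine ⟨.seq p q, T + T', ?_⟩
      convert h.seq h' using 1
      funext x
      by_cases hx : x = r
      · subst hx; simp [hr]
      · simp [hx]
  simpa using h Finset.univ

end RunsIn

/-- The program obtained by renaming the registers. -/
def Prog.map {R R' : Type} (e : R → R') : Prog R → Prog R'
  | nop => nop
  | push r a => push (e r) a
  | pop r => pop (e r)
  | seq p q => seq (p.map e) (q.map e)
  | case r f => case (e r) fun o => (f o).map e
  | loop r p => loop (e r) (p.map e)

/-- A renamed program acts on the renamed registers and leaves the others unchanged. -/
theorem Runs.exists_map {R R' : Type} [DecidableEq R] [DecidableEq R'] {e : R → R'}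
    (he : Injective e) {p : Prog R} {S S' : Store R} {t : ℕ} (h : Runs p S S' t) (U : Store R')
    (hU : ∀ r, U (e r) = S r) :
    ∃ U', Runs (p.map e) U U' t ∧ (∀ r, U' (e r) = S' r) ∧
      ∀ x, (∀ r, x ≠ e r) → U' x = U x := by
  induction h generalizing U with
  | nop S => exact ⟨U, .nop U, hU, fun _ _ => rfl⟩
  | push r a S =>
    refine ⟨_, .push (e r) a U, fun x => ?_, fun x hx => by simp [hx r]⟩
    by_cases hx : x = r
    · subst hx; simp [hU]
    · simp [hx, he.ne hx, hU]
  | pop r S =>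
    refine ⟨_, .pop (e r) U, fun x => ?_, fun x hx => by simp [hx r]⟩
    by_cases hx : x = r
    · subst hx; simp [hU]
    · simp [hx, he.ne hx, hU]
  | seq _ _ ih₁ ih₂ =>
    obtain ⟨U₁, hr₁, hU₁, hf₁⟩ := ih₁ U hU
    obtain ⟨U₂, hr₂, hU₂, hf₂⟩ := ih₂ U₁ hU₁
    exact ⟨U₂, hr₁.seq hr₂, hU₂, fun x hx => (hf₂ x hx).trans (hf₁ x hx)⟩
  | @case r f S S' t _ ih =>
    obtain ⟨U', hr, hU', hf⟩ := ih U hU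
    refine ⟨U', ?_, hU', hf⟩
    rw [← hU] at hr
    exact .case (f := fun o => (f o).map e) hr
  | loop_done h => exact ⟨U, .loop_done (by rw [hU, h]), hU, fun _ _ => rfl⟩
  | loop_step h _ _ ih₁ ih₂ =>
    obtain ⟨U₁, hr₁, hU₁, hf₁⟩ := ih₁ U hU
    obtain ⟨U₂, hr₂, hU₂, hf₂⟩ := ih₂ U₁ hU₁
    exact ⟨U₂, .loop_step (by rwa [hU]) hr₁ hr₂, hU₂, fun x hx => (hf₂ x hx).trans (hf₁ x hx)⟩

theorem RunsIn.map {R R' : Type} [DecidableEq R] [DecidableEq R'] {e : R → R'}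
    (he : Injective e) {p : Prog R} {S S' : Store R} {T : ℕ} (h : RunsIn p S S' T)
    {U U' : Store R'} (hU : ∀ r, U (e r) = S r) (hU' : ∀ r, U' (e r) = S' r)
    (hf : ∀ x, (∀ r, x ≠ e r) → U' x = U x) : RunsIn (p.map e) U U' T := by
  obtain ⟨t, ht, hr⟩ := h
  obtain ⟨V, hV, hV', hVf⟩ := hr.exists_map he U hU
  refine ⟨t, ht, ?_⟩
  convert hV using 1
  funext x
  by_cases hx : ∃ r, x = e r
  · obtain ⟨r, rfl⟩ := hx
    rw [hU', hV']
  · push Not at hx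
    rw [hf x hx, hVf x hx]

/-! ### Polynomial-time functions -/

/-- A type whose elements are stored in finitely many registers. -/
class Storable (α : Type) where
  /-- the registers used for an element -/
  Reg : Type
  [fintypeReg : Fintype Reg]
  [decidableEqReg : DecidableEq Reg]
  /-- the contents of the registers for an element -/
  store : α → Store Reg

attribute [reducible, instance] Storable.fintypeReg Storable.decidableEqReg

open Storable

instance : Storable (List Symb) where
  Reg := Unit
  store l _ := l

instance : Storable Symb where
  Reg := Unit
  store s _ := [s]

instance {α β : Type} [Storable α] [Storable β] : Storable (α × β) where
  Reg := Reg α ⊕ Reg β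
  store p := Sum.elim (store p.1) (store p.2)

/-- The number of symbols needed to store an element. -/
def size {α : Type} [Storable α] (a : α) : ℕ := ∑ r, (store a r).length

section size

variable {α β : Type} [Storable α] [Storable β]

theorem length_store_le (a : α) (r : Reg α) : (store a r).length ≤ size a :=
  Finset.single_le_sum (f := fun r => (store a r).length) (fun _ _ => Nat.zero_le _)
    (Finset.mem_univ r)

@[simp] theorem size_list (l : List Symb) : size l = l.length := by
  simp [size, store, Reg]

@[simp] theorem size_symb (s : Symb) : size s = 1 := by
  simp [size, store, Reg]

@[simp] theorem size_prod (p : α × β) : size p = size p.1 + size p.2 :=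
  Fintype.sum_sum_type _

end size

theorem eval_le_eval (P : Polynomial ℕ) {a b : ℕ} (h : a ≤ b) : P.eval a ≤ P.eval b := by
  simp only [Polynomial.eval_eq_sum_range]
  gcongr

/-- The store that holds an input, an output and auxiliary strings. -/
abbrev ioStore {A B W : Type} (a : Store A) (b : Store B) (w : Store W) : Store (A ⊕ B ⊕ W) :=
  Sum.elim a (Sum.elim b w)

/-- A function is polynomial-time computable if a register program writes its value into initially
empty registers, keeps the argument, leaves all auxiliary registers empty, and takes a number of
steps that is polynomial in the size of the argument. -/
@[fun_prop]
def PolyTime {α β : Type} [Storable α] [Storable β] (f : α → β) : Prop :=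
  ∃ (W : Type) (_ : Fintype W) (_ : DecidableEq W) (p : Prog (Reg α ⊕ Reg β ⊕ W))
    (P : Polynomial ℕ), ∀ a,
    RunsIn p (ioStore (store a) (fun _ => []) fun _ => [])
      (ioStore (store a) (store (f a)) fun _ => []) (P.eval (size a))

namespace PolyTime

variable {α β γ : Type} [Storable α] [Storable β] [Storable γ]

/-- The value of a polynomial-time function has polynomial size. -/
theorem exists_size_le {f : α → β} (hf : PolyTime f) :
    ∃ P : Polynomial ℕ, ∀ a, size (f a) ≤ P.eval (size a) := by
  obtain ⟨W, _, _, p, P, hp⟩ := hf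
  refine ⟨Fintype.card (Reg β) • P, fun a => ?_⟩
  obtain ⟨t, ht, hr⟩ := hp a
  have h : ∀ r ∈ Finset.univ, (store (f a) r).length ≤ P.eval (size a) := fun r _ => by
    simpa using (hr.length_le (Sum.inr (Sum.inl r))).trans (Nat.add_le_add_left ht _)
  simpa [size] using Finset.sum_le_card_nsmul _ _ _ h

/-- Functions that only copy registers. -/
theorem of_copy {f : α → β} (e : Reg β → Reg α) (hf : ∀ a r, store (f a) r = store a (e r)) :
    PolyTime f := by
  refine ⟨Unit, inferInstance, inferInstance,
    .copyAll (fun r => Sum.inl (e r)) (fun r => Sum.inr (Sum.inl r)) (Sum.inr (Sum.inr ()))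
      Finset.univ.toList,
    Fintype.card (Reg β) • (11 * Polynomial.X + 2) + 1, fun a => ?_⟩
  obtain ⟨S', hS', hd, hx⟩ := runsIn_copyAll (src := fun r => Sum.inl (e r))
    (dst := fun r => (Sum.inr (Sum.inl r) : Reg α ⊕ Reg β ⊕ Unit)) (w := Sum.inr (Sum.inr ()))
    (fun _ _ h => by simpa using h) (by simp) (by simp) (by simp) (size a)
    Finset.univ.toList (Finset.nodup_toList _)
    (ioStore (store a) (fun _ => []) fun _ => []) rfl (fun _ _ => rfl)
    (fun r _ => length_store_le a (e r))
  have : S' = ioStore (store a) (store (f a)) fun _ => [] := by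
    funext x
    rcases x with x | x | x
    · exact hx _ (by simp)
    · rw [hd x (by simp)]; exact (hf a x).symm
    · exact hx _ (by simp)
  rw [← this]
  exact hS'.mono (by simp [mul_add])

theorem congr {f g : α → β} (hf : PolyTime f) (h : ∀ a, f a = g a) : PolyTime g :=
  funext h ▸ hf

@[fun_prop]
theorem id : PolyTime (fun a : α => a) := of_copy (fun r => r) fun _ _ => rfl

@[fun_prop]
theorem fst : PolyTime (Prod.fst : α × β → α) := of_copy Sum.inl fun _ _ => rfl

@[fun_prop]
theorem snd : PolyTime (Prod.snd : α × β → β) := of_copy Sum.inr fun _ _ => rfl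

@[fun_prop]
theorem comp {g : β → γ} {f : α → β} (hg : PolyTime g) (hf : PolyTime f) :
    PolyTime fun a => g (f a) := by
  obtain ⟨Q, hQ⟩ := hf.exists_size_le
  obtain ⟨W₁, _, _, p₁, P₁, h₁⟩ := hf
  obtain ⟨W₂, _, _, p₂, P₂, h₂⟩ := hg
  let e₁ : Reg α ⊕ Reg β ⊕ W₁ → Reg α ⊕ Reg γ ⊕ (Reg β ⊕ W₁ ⊕ W₂) :=
    Sum.elim Sum.inl (Sum.elim (fun x => .inr (.inr (.inl x))) fun x => .inr (.inr (.inr (.inl x))))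
  let e₂ : Reg β ⊕ Reg γ ⊕ W₂ → Reg α ⊕ Reg γ ⊕ (Reg β ⊕ W₁ ⊕ W₂) :=
    Sum.elim (fun x => .inr (.inr (.inl x)))
      (Sum.elim (fun x => .inr (.inl x)) fun x => .inr (.inr (.inr (.inr x))))
  refine ⟨Reg β ⊕ W₁ ⊕ W₂, inferInstance, inferInstance,
    .seq (p₁.map e₁) (.seq (p₂.map e₂)
      (.clearAll (Finset.univ.toList.map fun r => .inr (.inr (.inl r))))),
    P₁ + (P₂.comp Q + (Fintype.card (Reg β) • (2 * Q + 1) + 1)), fun a => ?_⟩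
  have r₁ := (h₁ a).map (e := e₁) (by rintro (_ | _ | _) (_ | _ | _) <;> simp [e₁])
    (U := ioStore (store a) (fun _ => []) fun _ => [])
    (U' := ioStore (store a) (fun _ => []) (Sum.elim (store (f a)) fun _ => []))
    (by rintro (_ | _ | _) <;> simp [e₁]) (by rintro (_ | _ | _) <;> simp [e₁])
    (by rintro (_ | _ | _ | _ | _) <;> simp [e₁])
  have r₂ := (h₂ (f a)).map (e := e₂) (by rintro (_ | _ | _) (_ | _ | _) <;> simp [e₂])
    (U := ioStore (store a) (fun _ => []) (Sum.elim (store (f a)) fun _ => []))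
    (U' := ioStore (store a) (store (g (f a))) (Sum.elim (store (f a)) fun _ => []))
    (by rintro (_ | _ | _) <;> simp [e₂]) (by rintro (_ | _ | _) <;> simp [e₂])
    (by rintro (_ | _ | _ | _ | _) <;> simp [e₂])
  have r₃ := runsIn_clearAll
    (Finset.univ.toList.map fun r : Reg β =>
      (.inr (.inr (.inl r)) : Reg α ⊕ Reg γ ⊕ (Reg β ⊕ W₁ ⊕ W₂)))
    (ioStore (store a) (store (g (f a))) (Sum.elim (store (f a)) fun _ => [])) (Q.eval (size a))
    (by simpa using fun r => (length_store_le (f a) r).trans (hQ a))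
  convert (r₁.seq (r₂.seq r₃)).mono ?_ using 1
  · funext x
    rcases x with x | x | x | x | x <;> simp
  · have := eval_le_eval P₂ (hQ a)
    simp [Polynomial.eval_comp]
    lia

@[fun_prop]
theorem pair {f : α → β} {g : α → γ} (hf : PolyTime f) (hg : PolyTime g) :
    PolyTime fun a => (f a, g a) := by
  obtain ⟨W₁, _, _, p₁, P₁, h₁⟩ := hf
  obtain ⟨W₂, _, _, p₂, P₂, h₂⟩ := hg
  let e₁ : Reg α ⊕ Reg β ⊕ W₁ → Reg α ⊕ (Reg β ⊕ Reg γ) ⊕ (W₁ ⊕ W₂) :=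
    Sum.elim Sum.inl (Sum.elim (fun x => .inr (.inl (.inl x))) fun x => .inr (.inr (.inl x)))
  let e₂ : Reg α ⊕ Reg γ ⊕ W₂ → Reg α ⊕ (Reg β ⊕ Reg γ) ⊕ (W₁ ⊕ W₂) :=
    Sum.elim Sum.inl (Sum.elim (fun x => .inr (.inl (.inr x))) fun x => .inr (.inr (.inr x)))
  refine ⟨W₁ ⊕ W₂, inferInstance, inferInstance, .seq (p₁.map e₁) (p₂.map e₂), P₁ + P₂,
    fun a => ?_⟩
  have r₁ := (h₁ a).map (e := e₁) (by rintro (_ | _ | _) (_ | _ | _) <;> simp [e₁])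
    (U := ioStore (store a) (fun _ => []) fun _ => [])
    (U' := ioStore (store a) (Sum.elim (store (f a)) fun _ => []) fun _ => [])
    (by rintro (_ | _ | _) <;> simp [e₁]) (by rintro (_ | _ | _) <;> simp [e₁])
    (by rintro (_ | (_ | _) | _ | _) <;> simp [e₁])
  have r₂ := (h₂ a).map (e := e₂) (by rintro (_ | _ | _) (_ | _ | _) <;> simp [e₂])
    (U := ioStore (store a) (Sum.elim (store (f a)) fun _ => []) fun _ => [])
    (U' := ioStore (store a) (Sum.elim (store (f a)) (store (g a))) fun _ => [])
    (by rintro (_ | _ | _) <;> simp [e₂]) (by rintro (_ | _ | _) <;> simp [e₂])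
    (by rintro (_ | (_ | _) | _ | _) <;> simp [e₂])
  exact (r₁.seq r₂).mono (by simp)

/-- Postprocessing the output of a function by a program on the output registers. -/
theorem of_output {f g : α → β} (hf : PolyTime f) (p : Prog (Reg β)) (c : ℕ)
    (hp : ∀ a, RunsIn p (store (f a)) (store (g a)) c) : PolyTime g := by
  obtain ⟨W, _, _, p₁, P, h⟩ := hf
  let e : Reg β → Reg α ⊕ Reg β ⊕ W := fun x => .inr (.inl x)
  refine ⟨W, inferInstance, inferInstance, .seq p₁ (p.map e), P + Polynomial.C c, fun a => ?_⟩
  have r := (hp a).map (e := e) (fun _ _ => by simp [e])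
    (U := ioStore (store a) (store (f a)) fun _ => [])
    (U' := ioStore (store a) (store (g a)) fun _ => [])
    (fun _ => rfl) (fun _ => rfl) (by rintro (_ | _ | _) <;> simp [e])
  exact ((h a).seq r).mono (by simp)

@[fun_prop]
theorem cons (s : Symb) {f : α → List Symb} (hf : PolyTime f) : PolyTime fun a => s :: f a :=
  hf.of_output (.push () s) 1 fun a => by
    refine ⟨1, le_rfl, ?_⟩
    convert Runs.push (R := Reg (List Symb)) () s _ using 1
    funext x
    simp [store, show x = () from rfl]

@[fun_prop]
theorem tail {f : α → List Symb} (hf : PolyTime f) : PolyTime fun a => (f a).tail :=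
  hf.of_output (.pop ()) 1 fun a => by
    refine ⟨1, le_rfl, ?_⟩
    convert Runs.pop (R := Reg (List Symb)) () _ using 1
    funext x
    simp [store, show x = () from rfl]

@[fun_prop]
theorem const (b : β) : PolyTime fun _ : α => b := by
  obtain ⟨p, T, h⟩ := exists_runsIn_write (store b)
  let e : Reg β → Reg α ⊕ Reg β ⊕ Empty := fun x => .inr (.inl x)
  refine ⟨Empty, inferInstance, inferInstance, p.map e, Polynomial.C T, fun a => ?_⟩
  simpa using h.map (e := e) (fun _ _ => by simp [e])
    (U := ioStore (store a) (fun _ => []) fun _ => [])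
    (U' := ioStore (store a) (store b) fun _ => [])
    (fun _ => rfl) (fun _ => rfl) (by rintro (_ | _ | _) <;> simp [e])

/-- Functions defined by cases on the top symbol of an input register. -/
theorem of_case (r : Reg α) {f : Option Symb → α → β} (hf : ∀ o, PolyTime (f o)) :
    PolyTime fun a => f (store a r).head? a := by
  choose W _ _ p P h using hf
  let e : (o : Option Symb) → Reg α ⊕ Reg β ⊕ W o → Reg α ⊕ Reg β ⊕ (Σ o, W o) :=
    fun o => Sum.map (fun x => x) (Sum.map (fun x => x) (Sigma.mk o))
  refine ⟨Σ o, W o, inferInstance, inferInstance, .case (.inl r) fun o => (p o).map (e o),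
    ∑ o, P o + 1, fun a => ?_⟩
  have r₁ := (h (store a r).head? a).map (e := e _)
    (by rintro (_ | _ | _) (_ | _ | _) <;> simp [e])
    (U := ioStore (store a) (fun _ => []) fun _ => [])
    (U' := ioStore (store a) (store (f (store a r).head? a)) fun _ => [])
    (by rintro (_ | _ | _) <;> simp [e]) (by rintro (_ | _ | _) <;> simp [e])
    (by rintro (_ | _ | _) <;> simp [e])
  refine (RunsIn.case (f := fun o => (p o).map (e o)) rfl r₁).mono ?_
  simpa [Polynomial.eval_finsetSum] using Finset.single_le_sum
    (f := fun o => (P o).eval (size a)) (fun _ _ => Nat.zero_le _) (Finset.mem_univ _)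

/-- Functions defined by cases on a symbol. -/
theorem caseSymb {f : Symb → α → β} {c : α → Symb} (hc : PolyTime c) (hf : ∀ s, PolyTime (f s)) :
    PolyTime fun a => f (c a) a :=
  (of_case (α := Symb × α) (Sum.inl ()) (f := fun o p => f (o.getD default) p.2)
    fun _ => (hf _).comp snd).comp (hc.pair id)

@[fun_prop]
theorem ite_eq (s : Symb) {c : α → Symb} {f g : α → β} (hc : PolyTime c) (hf : PolyTime f)
    (hg : PolyTime g) : PolyTime fun a => if c a = s then f a else g a :=
  caseSymb (f := fun x a => if x = s then f a else g a) hc fun x => by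
    by_cases h : x = s <;> simpa [h]

@[fun_prop]
theorem headD (s : Symb) {f : α → List Symb} (hf : PolyTime f) :
    PolyTime fun a => (f a).headD s :=
  ((of_case (α := List Symb) () (f := fun o _ => o.getD s) fun _ => const _).comp hf).congr
    fun a => by simp [store, List.headD_eq_head?_getD]

theorem symb₂ (F : Symb → Symb → Symb) {f g : α → Symb} (hf : PolyTime f) (hg : PolyTime g) :
    PolyTime fun a => F (f a) (g a) :=
  caseSymb (f := fun x a => F x (g a)) hf fun _ => caseSymb (f := fun y _ => F _ y) hg fun _ =>
    const _

/-! ### Folding over strings -/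

/-- The registers of the program for `PolyTime.foldl`, when `X` is the type of registers for a
value and `W` that of the auxiliary registers. -/
abbrev FoldReg (X W : Type) : Type := (Unit ⊕ X) ⊕ X ⊕ (Unit ⊕ Unit ⊕ X ⊕ W)

set_option synthInstance.maxSize 1000 in
instance (X W : Type) [DecidableEq X] [DecidableEq W] : DecidableEq (FoldReg X W) := inferInstance

/-- The contents of the registers of the program for `PolyTime.foldl`: the list `l` and the
initial value are the input, `x` is the current value, `L` the rest of the list, and `y` the next
value. -/
abbrev foldStore {W : Type} (l : List Symb) (x₀ x : Store (Reg α)) (L : List Symb)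
    (y : Store (Reg α)) :
    Store (FoldReg (Reg α) W) :=
  ioStore (Sum.elim (fun _ => l) x₀) x
    (Sum.elim (fun _ => L) (Sum.elim (fun _ => []) (Sum.elim y fun _ => [])))

/-- Folding a polynomial-time function over a string takes polynomial time if the values do not
grow too fast. -/
theorem foldl {f : Symb → α → α} (hf : ∀ s, PolyTime (f s)) (P : Polynomial ℕ)
    (hP : ∀ l x, size (List.foldl (fun x s => f s x) x l) ≤ P.eval (l.length + size x)) :
    PolyTime fun p : List Symb × α => p.1.foldl (fun x s => f s x) p.2 := by
  choose W _ _ p Q h using hf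
  let rl : FoldReg (Reg α) (Σ s, W s) := .inl (.inl ())
  let rx₀ : Reg α → FoldReg (Reg α) (Σ s, W s) := fun r => .inl (.inr r)
  let rx : Reg α → FoldReg (Reg α) (Σ s, W s) := fun r => .inr (.inl r)
  let rL : FoldReg (Reg α) (Σ s, W s) := .inr (.inr (.inl ()))
  let rt : FoldReg (Reg α) (Σ s, W s) := .inr (.inr (.inr (.inl ())))
  let ry : Reg α → FoldReg (Reg α) (Σ s, W s) := fun r => .inr (.inr (.inr (.inr (.inl r))))
  let e : (s : Symb) → Reg α ⊕ Reg α ⊕ W s → FoldReg (Reg α) (Σ s, W s) := fun s =>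
    Sum.elim rx (Sum.elim ry fun w => .inr (.inr (.inr (.inr (.inr ⟨s, w⟩)))))
  let us : List (Reg α) := Finset.univ.toList
  -- One iteration runs the program for `f s` from `rx` into `ry`, then copies the result back to `rx`
  -- and empties `ry`, so that it again starts with empty auxiliary registers.
  let step : Symb → Prog (FoldReg (Reg α) (Σ s, W s)) := fun s =>
    .seq (.pop rL) (.seq ((p s).map (e s)) (.seq (.clearAll (us.map rx))
      (.seq (.copyAll ry rx rt us) (.clearAll (us.map ry)))))
  let body : Prog (FoldReg (Reg α) (Σ s, W s)) := .case rL fun o => o.elim .nop step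
  let c := Fintype.card (Reg α)
  -- the time of one iteration, as a function of a bound on the sizes of the old and the new value
  let τ : Polynomial ℕ := 1 + (∑ s, Q s + (c • (2 * Polynomial.X + 1) + 1 +
    (c • (11 * Polynomial.X + 2) + 1 + (c • (2 * Polynomial.X + 1) + 1)))) + 1
  have hbody : ∀ N s l₀ x₀ x L, size x ≤ N → size (f s x) ≤ N →
      RunsIn body (foldStore l₀ (store x₀) (store x) (s :: L) fun _ => [])
        (foldStore l₀ (store x₀) (store (f s x)) L fun _ => []) (τ.eval N) := by
    intro N s l₀ x₀ x L hx hfx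
    have r₁ : RunsIn (.pop rL) (foldStore l₀ (store x₀) (store x) (s :: L) fun _ => [])
        (foldStore l₀ (store x₀) (store x) L fun _ => []) 1 := by
      refine ⟨1, le_rfl, ?_⟩
      convert Runs.pop rL (foldStore l₀ (store x₀) (store x) (s :: L) fun _ => []) using 1
      funext r
      rcases r with (_ | _) | _ | _ | _ | _ | _ <;> simp [rL]
    have r₂ := (h s x).map (e := e s)
      (by rintro (_ | _ | _) (_ | _ | _) <;> simp [e, rx, ry])
      (U := foldStore l₀ (store x₀) (store x) L fun _ => [])
      (U' := foldStore l₀ (store x₀) (store x) L (store (f s x)))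
      (by rintro (_ | _ | _) <;> simp [e, rx, ry]) (by rintro (_ | _ | _) <;> simp [e, rx, ry])
      (by rintro ((_ | _) | _ | _ | _ | _ | _) <;> simp [e, rx, ry])
    have r₃ : RunsIn (.clearAll (us.map rx))
        (foldStore l₀ (store x₀) (store x) L (store (f s x)))
        (foldStore l₀ (store x₀) (fun _ => []) L (store (f s x))) (c * (2 * N + 1) + 1) := by
      convert runsIn_clearAll (us.map rx) (foldStore l₀ (store x₀) (store x) L (store (f s x))) N
        (by simpa [rx, us] using fun r => (length_store_le x r).trans hx) using 1
      · funext r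
        rcases r with (_ | _) | _ | _ | _ | _ | _ <;> simp [rx, us]
      · simp [us, c]
    have r₄ : RunsIn (.copyAll ry rx rt us)
        (foldStore l₀ (store x₀) (fun _ => []) L (store (f s x)))
        (foldStore l₀ (store x₀) (store (f s x)) L (store (f s x))) (c * (11 * N + 2) + 1) := by
      obtain ⟨S', hS', hd, hr⟩ := runsIn_copyAll (src := ry) (dst := rx) (w := rt)
        (fun _ _ h => by simpa [rx] using h) (by simp [ry, rx]) (by simp [ry, rt])
        (by simp [rx, rt]) N us (Finset.nodup_toList _)
        (foldStore l₀ (store x₀) (fun _ => []) L (store (f s x))) rfl (fun _ _ => rfl)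
        (fun r _ => (length_store_le (f s x) r).trans hfx)
      have : S' = foldStore l₀ (store x₀) (store (f s x)) L (store (f s x)) := by
        funext r
        rcases r with (r | r) | r | r | r | r | r
        case inr.inl => exact hd r (by simp [us])
        all_goals exact hr _ (by simp [rx])
      rw [← this]
      exact hS'.mono (by simp [us, c])
    have r₅ : RunsIn (.clearAll (us.map ry))
        (foldStore l₀ (store x₀) (store (f s x)) L (store (f s x)))
        (foldStore l₀ (store x₀) (store (f s x)) L fun _ => []) (c * (2 * N + 1) + 1) := by
      convert runsIn_clearAll (us.map ry)
        (foldStore l₀ (store x₀) (store (f s x)) L (store (f s x))) N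
        (by simpa [ry, us] using fun r => (length_store_le (f s x) r).trans hfx) using 1
      · funext r
        rcases r with (_ | _) | _ | _ | _ | _ | _ <;> simp [ry, us]
      · simp [us, c]
    refine (RunsIn.case (f := fun o => o.elim .nop step) (o := some s) rfl
      (r₁.seq (r₂.seq (r₃.seq (r₄.seq r₅))))).mono ?_
    have h₁ := eval_le_eval (Q s) hx
    have h₂ := Finset.single_le_sum (f := fun s => (Q s).eval N) (fun _ _ => Nat.zero_le _)
      (Finset.mem_univ s)
    simp only [τ, c, Polynomial.eval_finsetSum, Polynomial.eval_add, Polynomial.eval_one,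
      Polynomial.eval_smul, Polynomial.eval_mul, Polynomial.eval_ofNat, Polynomial.eval_X,
      smul_eq_mul]
    lia
  have hloop : ∀ N l l₀ x₀ x, (∀ l', l' <+: l → size (l'.foldl (fun x s => f s x) x) ≤ N) →
      RunsIn (.loop rL body) (foldStore l₀ (store x₀) (store x) l fun _ => [])
        (foldStore l₀ (store x₀) (store (l.foldl (fun x s => f s x) x)) [] fun _ => [])
        (l.length * (τ.eval N + 1) + 1) := by
    intro N l l₀ x₀ x hN
    induction l generalizing x with
    | nil => exact ⟨1, by simp, .loop_done rfl⟩
    | cons s l ih =>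
      have h₁ := hbody N s l₀ x₀ x l (hN [] (by simp)) (hN [s] (by simp))
      have h₂ := ih (f s x) fun l' hl' => hN (s :: l') (by simpa using hl')
      refine (RunsIn.loop_step (by simp [rL]) h₁ h₂).mono ?_
      simp only [List.length_cons]
      lia
  refine ⟨_, inferInstance, inferInstance, .seq (.copy rl rL rt) (.seq (.copyAll rx₀ rx rt us)
    (.loop rL body)), (11 * Polynomial.X + 2) + ((c • (11 * Polynomial.X + 2) + 1) +
    (Polynomial.X * (τ.comp P + 1) + 1)), fun ⟨l, x⟩ => ?_⟩
  have r₁ : RunsIn (.copy rl rL rt) (foldStore l (store x) (fun _ => []) [] fun _ => [])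
      (foldStore l (store x) (fun _ => []) l fun _ => []) (11 * l.length + 2) := by
    convert runsIn_copy (r := rl) (d := rL) (w := rt) (by simp [rl, rL]) (by simp [rl, rt])
      (by simp [rL, rt]) (S := foldStore l (store x) (fun _ => []) [] fun _ => []) rfl rfl using 1
    · funext r
      rcases r with (_ | _) | _ | _ | _ | _ | _ <;> simp [rL, rl]
    · rfl
  have r₂ : RunsIn (.copyAll rx₀ rx rt us)
      (foldStore l (store x) (fun _ => []) l fun _ => [])
      (foldStore l (store x) (store x) l fun _ => []) (c * (11 * size x + 2) + 1) := by
    obtain ⟨S', hS', hd, hr⟩ := runsIn_copyAll (src := rx₀) (dst := rx) (w := rt)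
      (fun _ _ h => by simpa [rx] using h) (by simp [rx₀, rx]) (by simp [rx₀, rt])
      (by simp [rx, rt]) (size x) us (Finset.nodup_toList _)
      (foldStore l (store x) (fun _ => []) l fun _ => []) rfl (fun _ _ => rfl)
      (fun r _ => length_store_le x r)
    have : S' = foldStore l (store x) (store x) l fun _ => [] := by
      funext r
      rcases r with (r | r) | r | r | r | r | r
      case inr.inl => exact hd r (by simp [us])
      all_goals exact hr _ (by simp [rx])
    rw [← this]
    exact hS'.mono (by simp [us, c])
  have r₃ := hloop (P.eval (l.length + size x)) l l x x fun l' hl' =>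
    (hP l' x).trans (eval_le_eval P (Nat.add_le_add_right hl'.length_le _))
  have r := r₁.seq (r₂.seq r₃)
  have hin : (ioStore (store (l, x)) (fun _ => []) fun _ => [] :
      Store (FoldReg (Reg α) (Σ s, W s))) =
      foldStore l (store x) (fun _ => []) [] fun _ => [] := by
    funext r
    rcases r with (_ | _) | _ | _ | _ | _ | _ <;> rfl
  have hout : ∀ y : α, (ioStore (store (l, x)) (store y) fun _ => [] :
      Store (FoldReg (Reg α) (Σ s, W s))) =
      foldStore l (store x) (store y) [] fun _ => [] := by
    intro y
    funext r
    rcases r with (_ | _) | _ | _ | _ | _ | _ <;> rfl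
  rw [hin, hout]
  refine r.mono ?_
  simp [Polynomial.eval_comp]
  gcongr <;> lia

/-- A polynomial-time function of strings is computed by a Turing machine in polynomial time. -/
theorem tm2ComputableInPolyTime {F : List Symb → List Symb} (hF : PolyTime F) {I : Type}
    (e : I → List Symb) :
    Nonempty (Turing.TM2ComputableInPolyTime e (_root_.id : List Symb → List Symb)
      fun x => F (e x)) := by
  obtain ⟨W, _, _, p, P, hp⟩ := hF
  refine Prog.tm2ComputableInPolyTime (R := Unit ⊕ Unit ⊕ W) (.seq p (.clear (.inl ())))
    (.inl ()) (.inr (.inl ())) e _ (P + (2 * Polynomial.X + 1)) fun x => ?_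
  have r₁ := hp (e x)
  have r₂ := runsIn_clear (.inl ()) (ioStore (store (e x)) (store (F (e x))) fun _ : W => [])
  have hin : (fun r : Unit ⊕ Unit ⊕ W => if r = .inl () then e x else []) =
      ioStore (store (e x)) (fun _ => []) fun _ => [] := by
    funext r
    rcases r with _ | _ | _ <;> simp [store]
  have hout : (fun r : Unit ⊕ Unit ⊕ W => if r = .inr (.inl ()) then F (e x) else []) =
      update (ioStore (store (e x)) (store (F (e x))) fun _ => []) (.inl ()) [] := by
    funext r
    rcases r with _ | _ | _ <;> simp [store]
  rw [hin, hout]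
  exact (r₁.seq r₂).mono (by simp [store])

end PolyTime

/-! ### Folds with a parameter, and operations on strings -/

namespace PolyTime

variable {α γ η ξ : Type} [Storable α] [Storable γ] [Storable η] [Storable ξ]

/-- Folding over a string with a parameter `c` and a state of two parts: a part `y` that develops
on its own and grows by at most `k` symbols in each step, and a part `x` that grows by an amount
that is polynomial in the sizes of `c` and `y`, but does not depend on `x`. -/
theorem foldl₂ {f₁ : Symb → η → η} {f₂ : γ → Symb → η → ξ → ξ} (h₁ : ∀ s, PolyTime (f₁ s))
    (h₂ : ∀ s, PolyTime fun p : γ × η × ξ => f₂ p.1 s p.2.1 p.2.2) (k : ℕ)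
    (hk : ∀ s y, size (f₁ s y) ≤ size y + k) (Q : Polynomial ℕ)
    (hQ : ∀ c s y x, size (f₂ c s y x) ≤ size x + Q.eval (size c + size y))
    {l : α → List Symb} {c : α → γ} {y : α → η} {x : α → ξ} (hl : PolyTime l) (hc : PolyTime c)
    (hy : PolyTime y) (hx : PolyTime x) :
    PolyTime fun a => (l a).foldl (fun p s => (f₁ s p.1, f₂ (c a) s p.1 p.2)) (y a, x a) := by
  let f : Symb → γ × η × ξ → γ × η × ξ := fun s p => (p.1, f₁ s p.2.1, f₂ p.1 s p.2.1 p.2.2)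
  have hf : ∀ s, PolyTime (f s) := fun s =>
    fst.pair (((h₁ s).comp (fst.comp snd)).pair (h₂ s))
  have hfold : ∀ (l : List Symb) (c : γ) (y : η) (x : ξ), l.foldl (fun p s => f s p) (c, y, x) =
      (c, l.foldl (fun p s => (f₁ s p.1, f₂ c s p.1 p.2)) (y, x)) := by
    intro l
    induction l with
    | nil => intros; rfl
    | cons s l ih => intro c y x; exact ih c _ _
  have hsize : ∀ (l : List Symb) (c : γ) (y : η) (x : ξ) (N : ℕ),
      size c + size y + k * l.length ≤ N →
      size (l.foldl (fun p s => (f₁ s p.1, f₂ c s p.1 p.2)) (y, x)) ≤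
        size y + k * l.length + size x + l.length * Q.eval N := by
    intro l
    induction l with
    | nil => intros; simp
    | cons s l ih =>
      intro c y x N hN
      simp only [List.length_cons, List.foldl_cons] at hN ⊢
      have e₁ := hk s y
      have e₂ := (hQ c s y x).trans (Nat.add_le_add_left
        (eval_le_eval Q (show size c + size y ≤ N by lia)) _)
      have e₃ := ih c (f₁ s y) (f₂ c s y x) N (by lia)
      lia
  have hfoldl := PolyTime.foldl hf
    (Polynomial.X + k • Polynomial.X + Polynomial.X * Q.comp (Polynomial.X + k • Polynomial.X))
    (by
      rintro l ⟨c, y, x⟩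
      rw [hfold, size_prod]
      have h := hsize l c y x _ le_rfl
      have hQ' := eval_le_eval Q (show size c + size y + k * l.length ≤
        l.length + size (c, y, x) + k * (l.length + size (c, y, x)) by simp; lia)
      have hm := Nat.mul_le_mul (show l.length ≤ l.length + size (c, y, x) by lia) hQ'
      simp only [size_prod, Polynomial.eval_add, Polynomial.eval_mul, Polynomial.eval_X,
        Polynomial.eval_smul, Polynomial.eval_comp, smul_eq_mul] at h hm ⊢
      lia)
  exact (snd.comp (hfoldl.comp (hl.pair (hc.pair (hy.pair hx))))).congr fun a => by
    simp [hfold]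

/-- Folding over a string, when each step enlarges the state by an amount that is polynomial in the
size of a parameter `c`. -/
theorem foldl_of_size_le {f : γ → Symb → ξ → ξ}
    (hf : ∀ s, PolyTime fun p : γ × ξ => f p.1 s p.2) (Q : Polynomial ℕ)
    (hQ : ∀ c s x, size (f c s x) ≤ size x + Q.eval (size c))
    {l : α → List Symb} {c : α → γ} {x : α → ξ} (hl : PolyTime l) (hc : PolyTime c)
    (hx : PolyTime x) : PolyTime fun a => (l a).foldl (fun x s => f (c a) s x) (x a) := by
  refine (snd.comp (foldl₂ (f₁ := fun _ y => y) (f₂ := fun c s _ x => f c s x) (η := Symb)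
    (fun _ => id) (fun s => (hf s).comp (fst.pair (snd.comp snd))) 0 (fun _ _ => le_rfl)
    Q (fun c s y x => (hQ c s x).trans (Nat.add_le_add_left (eval_le_eval Q (by lia)) _))
    hl hc (const default) hx)).congr fun a => ?_
  generalize x a = x
  induction l a generalizing x with
  | nil => rfl
  | cons s l ih => exact ih _

theorem symb₃ (F : Symb → Symb → Symb → Symb) {f g h : α → Symb} (hf : PolyTime f)
    (hg : PolyTime g) (hh : PolyTime h) : PolyTime fun a => F (f a) (g a) (h a) :=
  caseSymb (f := fun x a => F x (g a) (h a)) hf fun _ => symb₂ _ hg hh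

@[fun_prop]
theorem reverse {f : α → List Symb} (hf : PolyTime f) : PolyTime fun a => (f a).reverse :=
  (foldl_of_size_le (f := fun (_ : Symb) s x => s :: x) (fun s => by fun_prop) 1 (by simp) hf
    (const default) (const [])).congr fun a => by simp

@[fun_prop]
theorem append {f g : α → List Symb} (hf : PolyTime f) (hg : PolyTime g) :
    PolyTime fun a => f a ++ g a :=
  (foldl_of_size_le (f := fun (_ : Symb) s x => s :: x) (fun s => by fun_prop) 1 (by simp)
    hf.reverse (const default) hg).congr fun a => by simp

/-- A string with a single symbol. -/
@[fun_prop]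
theorem singleton {f : α → Symb} (hf : PolyTime f) : PolyTime fun a => [f a] :=
  caseSymb (f := fun s _ => [s]) hf fun _ => const _

theorem map (F : Symb → Symb) {f : α → List Symb} (hf : PolyTime f) :
    PolyTime fun a => (f a).map F :=
  (foldl_of_size_le (f := fun (_ : Symb) s x => F s :: x) (fun s => by fun_prop) 1 (by simp)
    hf.reverse (const default) (const [])).congr fun a => by
      induction f a <;> simp_all

end PolyTime

/-! ### Binary arithmetic -/

/-- The number that a symbol stands for as a binary digit. -/
def bitVal (s : Symb) : ℕ := if s = Γ'.bit true then 1 else 0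

/-- The number that a string stands for in binary, with the least significant digit first. -/
def binVal : List Symb → ℕ
  | [] => 0
  | s :: l => bitVal s + 2 * binVal l

@[simp] theorem bitVal_bit (b : Bool) : bitVal (Γ'.bit b) = b.toNat := by cases b <;> rfl

theorem bitVal_le_one (s : Symb) : bitVal s ≤ 1 := by unfold bitVal; split <;> simp

@[simp] theorem binVal_nil : binVal [] = 0 := rfl

@[simp] theorem binVal_cons (s : Symb) (l : List Symb) :
    binVal (s :: l) = bitVal s + 2 * binVal l := rfl

@[simp] theorem binVal_append (l l' : List Symb) :
    binVal (l ++ l') = binVal l + 2 ^ l.length * binVal l' := by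
  induction l with
  | nil => simp
  | cons s l ih => simp [ih]; ring

theorem binVal_eq_headD (l : List Symb) :
    binVal l = bitVal (l.headD Γ'.blank) + 2 * binVal l.tail := by
  cases l <;> simp [bitVal]

theorem binVal_encodeNat (n : ℕ) : binVal (encodingNatΓ'.encode n) = n := by
  have h : ∀ p : PosNum, binVal ((encodePosNum p).map Γ'.bit) = p := by
    intro p
    induction p with
    | one => simp [encodePosNum]
    | bit0 p ih => simp [encodePosNum, ih, PosNum.cast_bit0, two_mul]
    | bit1 p ih => simp [encodePosNum, ih, PosNum.cast_bit1, two_mul, Nat.add_comm]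
  have h' : ∀ p : Num, binVal ((encodeNum p).map Γ'.bit) = p := by
    rintro (_ | p)
    · simp [encodeNum]
    · simpa [encodeNum] using h p
  exact (h' n).trans (Num.to_of_nat n)

/-- The carry in the addition of three binary digits. -/
def carry (a b c : Symb) : Symb := Γ'.bit (decide (2 ≤ bitVal a + bitVal b + bitVal c))

/-- The last digit of the sum of three binary digits. -/
def sumDigit (a b c : Symb) : Symb := Γ'.bit (decide ((bitVal a + bitVal b + bitVal c) % 2 = 1))

/-- One step of the addition of `x` and `y` with carry `c`, for the state `(x, y, c, z)`, where `z`
holds the digits of the sum that are already known. -/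
def addStep (p : List Symb × List Symb × Symb × List Symb) :
    List Symb × List Symb × Symb × List Symb :=
  (p.1.tail, p.2.1.tail, carry (p.1.headD Γ'.blank) (p.2.1.headD Γ'.blank) p.2.2.1,
    p.2.2.2 ++ [sumDigit (p.1.headD Γ'.blank) (p.2.1.headD Γ'.blank) p.2.2.1])

/-- The sum of two binary numbers. The string `x ++ y` only serves as a counter that is long enough
for all digits of `x` and `y`. -/
def add (x y : List Symb) : List Symb :=
  let r := (x ++ y).foldl (fun p _ => addStep p) (x, y, Γ'.bit false, [])
  r.2.2.2 ++ [r.2.2.1]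

theorem binVal_foldl_addStep (l x y : List Symb) (c : Symb) (z : List Symb)
    (hx : x.length ≤ l.length) (hy : y.length ≤ l.length) :
    let r := l.foldl (fun p _ => addStep p) (x, y, c, z)
    binVal (r.2.2.2 ++ [r.2.2.1]) = binVal z + 2 ^ z.length * (binVal x + binVal y + bitVal c) := by
  induction l generalizing x y c z with
  | nil =>
    obtain rfl : x = [] := by simpa using hx
    obtain rfl : y = [] := by simpa using hy
    simp
  | cons s l ih =>
    simp only [List.foldl_cons]
    refine (ih _ _ _ _ (by simp at hx ⊢; lia) (by simp at hy ⊢; lia)).trans ?_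
    rw [binVal_eq_headD x, binVal_eq_headD y]
    simp only [carry, sumDigit, binVal_append, binVal_cons, binVal_nil,
      List.length_append, List.length_cons, List.length_nil, pow_succ]
    have ha := bitVal_le_one (x.headD Γ'.blank)
    have hb := bitVal_le_one (y.headD Γ'.blank)
    have hc := bitVal_le_one c
    generalize bitVal (x.headD Γ'.blank) = a at *
    generalize bitVal (y.headD Γ'.blank) = b at *
    generalize bitVal c = c at *
    interval_cases a <;> interval_cases b <;> interval_cases c <;> simp <;> ring

theorem binVal_add (x y : List Symb) : binVal (add x y) = binVal x + binVal y := by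
  have h := binVal_foldl_addStep (x ++ y) x y (Γ'.bit false) [] (by simp) (by simp)
  simpa [add] using h

theorem length_add (x y : List Symb) : (add x y).length = x.length + y.length + 1 := by
  have h : ∀ (l : List Symb) p, (l.foldl (fun p _ => addStep p) p).2.2.2.length =
      p.2.2.2.length + l.length := by
    intro l
    induction l with
    | nil => simp
    | cons s l ih =>
      intro p
      have hp : (addStep p).2.2.2.length = p.2.2.2.length + 1 := by simp [addStep]
      rw [List.foldl_cons, ih, hp, List.length_cons]
      lia
  simp [add, h]

@[fun_prop]
theorem PolyTime.add {α : Type} [Storable α] {f g : α → List Symb} (hf : PolyTime f)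
    (hg : PolyTime g) : PolyTime fun a => add (f a) (g a) := by
  have hstep : PolyTime addStep :=
    PolyTime.pair (by fun_prop) (PolyTime.pair (by fun_prop) (PolyTime.pair
      (PolyTime.symb₃ carry (by fun_prop) (by fun_prop) (by fun_prop))
        (PolyTime.append (by fun_prop)
          (PolyTime.symb₃ sumDigit (by fun_prop) (by fun_prop) (by fun_prop)).singleton)))
  have h := PolyTime.foldl_of_size_le (f := fun (_ : Symb) _ p => addStep p)
    (fun _ => hstep.comp PolyTime.snd) 1 (by simp [addStep]; lia) (hf.append hg)
    (PolyTime.const default) (hf.pair (hg.pair (PolyTime.const (Γ'.bit false, []))))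
  exact PolyTime.append (by fun_prop) (PolyTime.singleton (by fun_prop))

/-- The product of two binary numbers. -/
def mul (x y : List Symb) : List Symb :=
  x.reverse.foldl (fun z s => add (Γ'.bit false :: z) (if s = Γ'.bit true then y else [])) []

theorem binVal_mul (x y : List Symb) : binVal (mul x y) = binVal x * binVal y := by
  rw [mul, List.foldl_reverse]
  induction x with
  | nil => simp
  | cons s x ih =>
    simp only [List.foldr_cons, binVal_add, binVal_cons, ih]
    by_cases hs : s = Γ'.bit true <;> simp [hs, bitVal] <;> ring

@[fun_prop]
theorem PolyTime.mul {α : Type} [Storable α] {f g : α → List Symb} (hf : PolyTime f)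
    (hg : PolyTime g) : PolyTime fun a => mul (f a) (g a) :=
  PolyTime.foldl_of_size_le
    (f := fun y s z => KDemand.add (Γ'.bit false :: z) (if s = Γ'.bit true then y else []))
    (fun s => by by_cases hs : s = Γ'.bit true <;> simp only [hs, if_true, if_false] <;> fun_prop)
    (Polynomial.X + 2)
    (fun y s z => by by_cases hs : s = Γ'.bit true <;> simp [hs, length_add] <;> lia)
    hf.reverse hg (PolyTime.const [])

/-- The truth value of `x < y` for binary numbers with leading digits `a` and `b`, when `r` is the
result of the comparison of the lower digits. -/
def lessDigit (a b r : Symb) : Symb :=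
  Γ'.bit (decide (bitVal a < bitVal b ∨ bitVal a = bitVal b ∧ bitVal r = 1))

/-- One step of the comparison of `x` and `y`, for the state `(x, y, r)`, where `r` is the result of
the comparison of the lower digits. -/
def lessStep (p : List Symb × List Symb × Symb) : List Symb × List Symb × Symb :=
  (p.1.tail, p.2.1.tail, lessDigit (p.1.headD Γ'.blank) (p.2.1.headD Γ'.blank) p.2.2)

/-- The truth value of `x < y` for binary numbers `x` and `y`. -/
def less (x y : List Symb) : Symb :=
  ((x ++ y).foldl (fun p _ => lessStep p) (x, y, Γ'.bit false)).2.2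

theorem less_eq (x y : List Symb) : less x y = Γ'.bit (decide (binVal x < binVal y)) := by
  have h : ∀ (l x y : List Symb) (r : Bool), x.length ≤ l.length → y.length ≤ l.length →
      (l.foldl (fun p _ => lessStep p) (x, y, Γ'.bit r)).2.2 =
        Γ'.bit (decide (binVal x < binVal y ∨ binVal x = binVal y ∧ r = true)) := by
    intro l
    induction l with
    | nil =>
      intro x y r hx hy
      obtain rfl : x = [] := by simpa using hx
      obtain rfl : y = [] := by simpa using hy
      simp
    | cons s l ih =>
      intro x y r hx hy
      refine (ih _ _ _ (by simp at hx ⊢; lia) (by simp at hy ⊢; lia)).trans ?_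
      rw [binVal_eq_headD x, binVal_eq_headD y]
      have ha := bitVal_le_one (x.headD Γ'.blank)
      have hb := bitVal_le_one (y.headD Γ'.blank)
      generalize x.headD Γ'.blank = a at *
      generalize y.headD Γ'.blank = b at *
      congr 2
      cases r <;> simp <;> lia
  simpa [less] using h (x ++ y) x y false (by simp) (by simp)

@[fun_prop]
theorem PolyTime.less {α : Type} [Storable α] {f g : α → List Symb} (hf : PolyTime f)
    (hg : PolyTime g) : PolyTime fun a => less (f a) (g a) := by
  have hstep : PolyTime lessStep :=
    PolyTime.pair (by fun_prop) (PolyTime.pair (by fun_prop)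
      (PolyTime.symb₃ lessDigit (by fun_prop) (by fun_prop) (by fun_prop)))
  have h := PolyTime.foldl_of_size_le (f := fun (_ : Symb) _ p => lessStep p)
    (fun _ => hstep.comp PolyTime.snd) 1 (by simp [lessStep]; lia) (hf.append hg)
    (PolyTime.const default) (hf.pair (hg.pair (PolyTime.const (Γ'.bit false))))
  exact PolyTime.snd.comp (PolyTime.snd.comp h)

/-! ### Characteristic strings of bundles -/

/-- Applies a function of two symbols to the corresponding symbols of two strings; the length of the
result is that of the first one. -/
def zipSymb (F : Symb → Symb → Symb) (x y : List Symb) : List Symb :=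
  (x.foldl (fun p s => (p.1.tail, p.2 ++ [F s (p.1.headD Γ'.blank)])) (y, [])).2

theorem zipSymb_map (F : Symb → Symb → Symb) {ι : Type} (f g : ι → Symb) (l : List ι) :
    zipSymb F (l.map f) (l.map g) = l.map fun i => F (f i) (g i) := by
  have h : ∀ z, ((l.map f).foldl (fun p s => (p.1.tail, p.2 ++ [F s (p.1.headD Γ'.blank)]))
      (l.map g, z)).2 = z ++ l.map fun i => F (f i) (g i) := by
    induction l with
    | nil => simp
    | cons i l ih => intro z; simpa using ih (z ++ [F (f i) (g i)])
  exact h []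

theorem PolyTime.zipSymb (F : Symb → Symb → Symb) {α : Type} [Storable α] {f g : α → List Symb}
    (hf : PolyTime f) (hg : PolyTime g) : PolyTime fun a => zipSymb F (f a) (g a) :=
  PolyTime.snd.comp (PolyTime.foldl_of_size_le
    (f := fun (_ : Symb) s p => (p.1.tail, p.2 ++ [F s (p.1.headD Γ'.blank)]))
    (fun s => PolyTime.pair (by fun_prop) (PolyTime.append (by fun_prop) (PolyTime.singleton
      (PolyTime.symb₂ F (PolyTime.const s) (by fun_prop)))))
    1 (by simp; lia) hf (PolyTime.const default) (hg.pair (PolyTime.const [])))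

/-- The digit of a union of bundles. -/
def orSymb (a b : Symb) : Symb := if a = Γ'.bit true then a else b

/-- The digit of an intersection of bundles. -/
def andSymb (a b : Symb) : Symb := if a = Γ'.bit true then b else a

/-- The digit of the complement of a bundle. -/
def notSymb (a : Symb) : Symb := if a = Γ'.bit true then Γ'.bit false else Γ'.bit true

/-- Whether the digit `1` occurs in a string. -/
def anySymb (l : List Symb) : Symb := l.foldl orSymb (Γ'.bit false)

theorem PolyTime.anySymb {α : Type} [Storable α] {f : α → List Symb} (hf : PolyTime f) :
    PolyTime fun a => anySymb (f a) :=
  PolyTime.foldl_of_size_le (f := fun (_ : Symb) s x => orSymb x s)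
    (fun s => PolyTime.symb₂ orSymb PolyTime.snd (PolyTime.const s)) 0 (by simp) hf
    (PolyTime.const default) (PolyTime.const _)

section bundle

variable {m : ℕ} (X Y : Finset (Fin m))

theorem zipSymb_or : zipSymb orSymb (encodeBundle X) (encodeBundle Y) = encodeBundle (X ∪ Y) := by
  rw [encodeBundle, encodeBundle, zipSymb_map, encodeBundle]
  refine List.map_congr_left fun j _ => ?_
  by_cases h : j ∈ X <;> simp [orSymb, h]

theorem anySymb_zipSymb_and : anySymb (zipSymb andSymb (encodeBundle X) (encodeBundle Y)) =
    Γ'.bit (decide (¬ Disjoint X Y)) := by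
  have h : ∀ (l : List (Fin m)) (b : Bool),
      (l.map fun j => Γ'.bit (decide (j ∈ X) && decide (j ∈ Y))).foldl orSymb (Γ'.bit b) =
        Γ'.bit (b || l.any fun j => decide (j ∈ X) && decide (j ∈ Y)) := by
    intro l
    induction l with
    | nil => simp
    | cons j l ih =>
      intro b
      have : orSymb (Γ'.bit b) (Γ'.bit (decide (j ∈ X) && decide (j ∈ Y))) =
          Γ'.bit (b || (decide (j ∈ X) && decide (j ∈ Y))) := by
        cases b <;> simp [orSymb]
      rw [List.map_cons, List.foldl_cons, this, ih, List.any_cons, Bool.or_assoc]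
  have h' : zipSymb andSymb (encodeBundle X) (encodeBundle Y) =
      (List.finRange m).map fun j => Γ'.bit (decide (j ∈ X) && decide (j ∈ Y)) := by
    rw [encodeBundle, encodeBundle, zipSymb_map]
    refine List.map_congr_left fun j _ => ?_
    by_cases h : j ∈ X <;> simp [andSymb, h]
  rw [h', anySymb, h, Bool.false_or]
  congr 1
  rw [Bool.eq_iff_iff]
  simp [Finset.not_disjoint_iff]

theorem map_notSymb_encodeBundle : (encodeBundle X).map notSymb = encodeBundle Xᶜ := by
  rw [encodeBundle, List.map_map, encodeBundle]
  refine List.map_congr_left fun j _ => ?_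
  by_cases h : j ∈ X <;> simp [notSymb, h]

theorem map_const_of_length_eq {l : List Symb} (hl : l.length = m) :
    (l.map fun _ => Γ'.bit false) = encodeBundle (∅ : Finset (Fin m)) := by
  subst hl
  simp [encodeBundle]

@[simp] theorem length_encodeBundle : (encodeBundle X).length = m := by simp [encodeBundle]

end bundle

/-! ### Reading a table of values -/

/-- The position of the reader of a table: before the table, between two entries, in one of the
three parts of an entry, or behind the table. -/
inductive Phase
  | start | table | bundle | num | den | done
  deriving DecidableEq

/-- Phases are written as symbols. -/
def Phase.toSymb : Phase → Symb
  | start => Γ'.blank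
  | table => Γ'.bra
  | bundle => Γ'.bit false
  | num => Γ'.bit true
  | den => Γ'.comma
  | done => Γ'.ket

instance : Storable Phase where
  Reg := Unit
  store p _ := [p.toSymb]

@[simp] theorem size_phase (p : Phase) : size p = 1 := by simp [size, store, Reg]

@[fun_prop]
theorem PolyTime.ite_phase {α β : Type} [Storable α] [Storable β] (q : Phase) {c : α → Phase}
    {f g : α → β} (hc : PolyTime c) (hf : PolyTime f) (hg : PolyTime g) :
    PolyTime fun a => if c a = q then f a else g a := by
  have h : PolyTime Phase.toSymb := .of_copy (fun r => r) fun _ _ => rfl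
  refine (PolyTime.ite_eq q.toSymb (h.comp hc) hf hg).congr fun a => ?_
  have : (c a).toSymb = q.toSymb ↔ c a = q := by cases c a <;> cases q <;> simp [Phase.toSymb]
  simp [this]

/-- An entry of a table: the strings for a bundle and for the numerator and the denominator of its
value. -/
abbrev Entry : Type := List Symb × List Symb × List Symb

/-- The state of the reader of a table: the phase, the current entry, and the symbols read behind
the table. -/
abbrev Reader : Type := Phase × Entry × List Symb

/-- The state of the reader after a further symbol `s`. -/
def readSymb (s : Symb) (p : Reader) : Reader :=
  if p.1 = .start then (.table, p.2)
  else if p.1 = .table then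
    if s = Γ'.bra then (.bundle, ([], [], []), p.2.2) else (.done, p.2)
  else if p.1 = .bundle then
    if s = Γ'.comma then (.num, p.2) else (.bundle, (p.2.1.1 ++ [s], p.2.1.2), p.2.2)
  else if p.1 = .num then
    if s = Γ'.comma then (.den, p.2)
    else (.num, (p.2.1.1, p.2.1.2.1 ++ [s], p.2.1.2.2), p.2.2)
  else if p.1 = .den then
    if s = Γ'.ket then (.table, p.2)
    else (.den, (p.2.1.1, p.2.1.2.1, p.2.1.2.2 ++ [s]), p.2.2)
  else (.done, p.2.1, p.2.2 ++ [s])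

theorem size_readSymb_le (s : Symb) (p : Reader) : size (readSymb s p) ≤ size p + 1 := by
  unfold readSymb
  split_ifs <;> simp <;> lia

theorem polyTime_readSymb (s : Symb) : PolyTime (readSymb s) := by
  unfold readSymb
  refine .ite_phase _ (by fun_prop) (by fun_prop) ?_
  refine .ite_phase _ (by fun_prop) (by split_ifs <;> fun_prop) ?_
  refine .ite_phase _ (by fun_prop) (by split_ifs <;> fun_prop) ?_
  refine .ite_phase _ (by fun_prop) (by split_ifs <;> fun_prop) ?_
  exact .ite_phase _ (by fun_prop) (by split_ifs <;> fun_prop) (by fun_prop)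

/-- One step of `foldEntries`: the state of the reader is updated, and `g c` is applied when an
entry is complete. -/
def foldStep {γ ξ : Type} (g : γ → Entry → ξ → ξ) (c : γ) (p : Reader × ξ) (s : Symb) :
    Reader × ξ :=
  (readSymb s p.1, if p.1.1 = .den then if s = Γ'.ket then g c p.1.2.1 p.2 else p.2 else p.2)

/-- Reads the table at the beginning of the string `l` and folds the function `g c` over its
entries. The state of the reader is returned as well, since it contains the rest of `l`. -/
def foldEntries {γ ξ : Type} (g : γ → Entry → ξ → ξ) (c : γ) (x : ξ) (l : List Symb) :
    Reader × ξ :=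
  l.foldl (foldStep g c) ((.start, ([], [], []), []), x)

theorem PolyTime.foldEntries {α γ ξ : Type} [Storable α] [Storable γ] [Storable ξ]
    {g : γ → Entry → ξ → ξ} (hg : PolyTime fun p : γ × Entry × ξ => g p.1 p.2.1 p.2.2)
    (Q : Polynomial ℕ) (hQ : ∀ c e x, size (g c e x) ≤ size x + Q.eval (size c + size e))
    {c : α → γ} {x : α → ξ} {l : α → List Symb} (hc : PolyTime c) (hx : PolyTime x)
    (hl : PolyTime l) : PolyTime fun a => foldEntries g (c a) (x a) (l a) := by
  refine PolyTime.foldl₂ (f₂ := fun c s (y : Reader) x =>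
      if y.1 = .den then if s = Γ'.ket then g c y.2.1 x else x else x)
    polyTime_readSymb (fun s => ?_) 1 size_readSymb_le Q (fun c s y x => ?_) hl hc
    (PolyTime.const _) hx
  · have h := hg.comp (f := fun p : γ × Reader × ξ => (p.1, p.2.1.2.1, p.2.2)) (by fun_prop)
    exact .ite_phase _ (by fun_prop) (by split_ifs <;> fun_prop) (by fun_prop)
  · split_ifs
    · exact (hQ c y.2.1 x).trans (Nat.add_le_add_left (eval_le_eval Q (by simp; lia)) _)
    · lia
    · lia

/-- The entry of a table for a bundle. -/
def entryOf {m : ℕ} (v : Finset (Fin m) → NNRat) (X : Finset (Fin m)) : Entry :=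
  (encodeBundle X, encodingNatΓ'.encode (v X).num, encodingNatΓ'.encode (v X).den)

theorem exists_bit_of_mem_encodeBundle {m : ℕ} (X : Finset (Fin m)) :
    ∀ s ∈ encodeBundle X, ∃ b, s = Γ'.bit b := by
  simp only [encodeBundle, List.mem_map]
  rintro _ ⟨j, -, rfl⟩
  exact ⟨_, rfl⟩

theorem exists_bit_of_mem_encodeNat (n : ℕ) : ∀ s ∈ encodingNatΓ'.encode n, ∃ b, s = Γ'.bit b := by
  simp only [encodingNatΓ', List.mem_map]
  rintro _ ⟨b, -, rfl⟩
  exact ⟨b, rfl⟩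

section foldEntries

variable {γ ξ : Type} (g : γ → Entry → ξ → ξ) (c : γ)

theorem foldl_foldStep_bundle (x : ξ) (b nu de r : List Symb) (l : List Symb)
    (hl : ∀ s ∈ l, ∃ b, s = Γ'.bit b) :
    l.foldl (foldStep g c) ((.bundle, (b, nu, de), r), x) =
      ((.bundle, (b ++ l, nu, de), r), x) := by
  induction l generalizing b with
  | nil => simp
  | cons s l ih =>
    obtain ⟨d, rfl⟩ := hl s (by simp)
    have := ih (b ++ [Γ'.bit d]) fun s hs => hl s (by simp [hs])
    simpa [foldStep, readSymb] using this

theorem foldl_foldStep_num (x : ξ) (b nu de r : List Symb) (l : List Symb)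
    (hl : ∀ s ∈ l, ∃ b, s = Γ'.bit b) :
    l.foldl (foldStep g c) ((.num, (b, nu, de), r), x) = ((.num, (b, nu ++ l, de), r), x) := by
  induction l generalizing nu with
  | nil => simp
  | cons s l ih =>
    obtain ⟨d, rfl⟩ := hl s (by simp)
    have := ih (nu ++ [Γ'.bit d]) fun s hs => hl s (by simp [hs])
    simpa [foldStep, readSymb] using this

theorem foldl_foldStep_den (x : ξ) (b nu de r : List Symb) (l : List Symb)
    (hl : ∀ s ∈ l, ∃ b, s = Γ'.bit b) :
    l.foldl (foldStep g c) ((.den, (b, nu, de), r), x) = ((.den, (b, nu, de ++ l), r), x) := by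
  induction l generalizing de with
  | nil => simp
  | cons s l ih =>
    obtain ⟨d, rfl⟩ := hl s (by simp)
    have := ih (de ++ [Γ'.bit d]) fun s hs => hl s (by simp [hs])
    simpa [foldStep, readSymb] using this

theorem foldl_foldStep_done (x : ξ) (e : Entry) (r l : List Symb) :
    l.foldl (foldStep g c) ((.done, e, r), x) = ((.done, e, r ++ l), x) := by
  induction l generalizing r with
  | nil => simp
  | cons s l ih => simpa [foldStep, readSymb] using ih (r ++ [s])

theorem foldl_foldStep_entry {m : ℕ} (v : Finset (Fin m) → NNRat) (X : Finset (Fin m))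
    (e : Entry) (r : List Symb) (x : ξ) :
    (Γ'.bra :: encodeBundle X ++ Γ'.comma :: encodeValue (v X) ++ [Γ'.ket]).foldl (foldStep g c)
      ((.table, e, r), x) = ((.table, entryOf v X, r), g c (entryOf v X) x) := by
  have h₁ : foldStep g c ((.table, e, r), x) Γ'.bra = ((.bundle, ([], [], []), r), x) := by
    simp [foldStep, readSymb]
  have h₂ : ∀ b nu de, foldStep g c ((.bundle, (b, nu, de), r), x) Γ'.comma =
      ((.num, (b, nu, de), r), x) := by simp [foldStep, readSymb]
  have h₃ : ∀ b nu de, foldStep g c ((.num, (b, nu, de), r), x) Γ'.comma =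
      ((.den, (b, nu, de), r), x) := by simp [foldStep, readSymb]
  have h₄ : ∀ e, foldStep g c ((.den, e, r), x) Γ'.ket = ((.table, e, r), g c e x) := by
    simp [foldStep, readSymb]
  simp only [encodeValue, List.foldl_append, List.foldl_cons, List.foldl_nil, h₁, h₂, h₃, h₄,
    foldl_foldStep_bundle g c _ _ _ _ _ _ (exists_bit_of_mem_encodeBundle X),
    foldl_foldStep_num g c _ _ _ _ _ _ (exists_bit_of_mem_encodeNat _),
    foldl_foldStep_den g c _ _ _ _ _ _ (exists_bit_of_mem_encodeNat _), List.nil_append]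
  rfl

/-- The reader finds all entries of a table, and the rest of the string. -/
theorem exists_foldEntries_eq (x : ξ) {k m : ℕ} (v : Finset (Fin m) → NNRat) (r : List Symb) :
    ∃ e, foldEntries g c x (encodeValuation k v ++ r) =
      ((.done, e, r), (smallBundles k m).foldl (fun x X => g c (entryOf v X) x) x) := by
  have h : ∀ (Xs : List (Finset (Fin m))) e x, ∃ e',
      (Xs.flatMap fun X => Γ'.bra :: encodeBundle X ++ Γ'.comma :: encodeValue (v X) ++
        [Γ'.ket]).foldl (foldStep g c) ((.table, e, []), x) =
      ((.table, e', []), Xs.foldl (fun x X => g c (entryOf v X) x) x) := by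
    intro Xs
    induction Xs with
    | nil => intro e x; exact ⟨e, rfl⟩
    | cons X Xs ih =>
      intro e x
      rw [List.flatMap_cons, List.foldl_append, foldl_foldStep_entry, List.foldl_cons]
      exact ih _ _
  obtain ⟨e, he⟩ := h (smallBundles k m) ([], [], []) x
  have h₀ : foldStep g c ((.start, ([], [], []), []), x) Γ'.bra =
      ((.table, ([], [], []), []), x) := by simp [foldStep, readSymb]
  have h₁ : ∀ e x, foldStep g c ((.table, e, []), x) Γ'.ket = ((.done, e, []), x) := by
    simp [foldStep, readSymb]
  refine ⟨e, ?_⟩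
  change (encodeValuation k v ++ r).foldl (foldStep g c) ((.start, ([], [], []), []), x) = _
  rw [encodeValuation, List.append_assoc, List.cons_append, List.foldl_cons, h₀,
    List.foldl_append, he, List.singleton_append, List.foldl_cons, h₁, foldl_foldStep_done,
    List.nil_append]

end foldEntries

/-! ### The search for an optimal allocation -/

/-- A partial allocation: the characteristic string of the set of allocated items, the list of the
bundles as a string, and the numerator and the denominator of their total value. -/
abbrev Candidate : Type := List Symb × List Symb × List Symb × List Symb

/-- Allocates a further bundle. -/
def Candidate.addEntry (c : Candidate) (e : Entry) : Candidate :=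
  (zipSymb orSymb c.1 e.1, c.2.1 ++ Γ'.bra :: (e.1 ++ [Γ'.ket]),
    add (mul c.2.2.1 e.2.2) (mul e.2.1 c.2.2.2), mul c.2.2.2 e.2.2)

/-- The candidate of larger value. -/
def Candidate.better (c d : Candidate) : Candidate :=
  if less (mul c.2.2.1 d.2.2.2) (mul d.2.2.1 c.2.2.2) = Γ'.bit true then d else c

/-- The entry for the empty bundle, when `l` is any string with one symbol for every item. -/
def emptyEntry (l : List Symb) : Entry := (l.map fun _ => Γ'.bit false, [], [Γ'.bit true])

/-- The part of a string behind the table at its beginning. -/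
def dropTable (l : List Symb) : List Symb :=
  (foldEntries (fun _ _ x => x) Γ'.blank Γ'.blank l).1.2.2

/-- Replaces the best candidate `x` found so far by the result of `f` on the extension of the
candidate `c.2` by the bundle of an entry `e`, if this is possible and an improvement. -/
def tryEntry (f : List Symb × Candidate → Candidate) (c : List Symb × Candidate) (e : Entry)
    (x : Candidate) : Candidate :=
  if anySymb (zipSymb andSymb c.2.1 e.1) = Γ'.bit true then x
  else x.better (f (c.1, c.2.addEntry e))

/-- An optimal extension of a candidate by bundles from the first `n` tables of a string. -/
def search : ℕ → List Symb × Candidate → Candidate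
  | 0, p => p.2
  | n + 1, p => (foldEntries (tryEntry (search n)) (dropTable p.1, p.2)
      (search n (dropTable p.1, p.2.addEntry (emptyEntry p.2.1))) p.1).2

section polyTime

variable {α : Type} [Storable α]

@[fun_prop]
theorem polyTime_addEntry {c : α → Candidate} {e : α → Entry} (hc : PolyTime c)
    (he : PolyTime e) : PolyTime fun a => (c a).addEntry (e a) :=
  .pair (.zipSymb _ (by fun_prop) (by fun_prop)) (by fun_prop)

@[fun_prop]
theorem polyTime_better {c d : α → Candidate} (hc : PolyTime c) (hd : PolyTime d) :
    PolyTime fun a => (c a).better (d a) := by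
  unfold Candidate.better
  fun_prop

@[fun_prop]
theorem polyTime_dropTable {l : α → List Symb} (hl : PolyTime l) :
    PolyTime fun a => dropTable (l a) := by
  have h := PolyTime.foldEntries (g := fun (_ : Symb) _ (x : Symb) => x) (by fun_prop) 0 (by simp)
    (.const Γ'.blank) (.const Γ'.blank) hl
  exact PolyTime.snd.comp (PolyTime.snd.comp (PolyTime.fst.comp h))

theorem polyTime_search (n : ℕ) : PolyTime (search n) := by
  induction n with
  | zero => exact PolyTime.snd
  | succ n ih =>
    have hf : PolyTime fun p : (List Symb × Candidate) × Entry =>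
        search n (p.1.1, p.1.2.addEntry p.2) := ih.comp (by fun_prop)
    obtain ⟨Q, hQ⟩ := hf.exists_size_le
    have hg : PolyTime fun p : (List Symb × Candidate) × Entry × Candidate =>
        tryEntry (search n) p.1 p.2.1 p.2.2 := by
      refine PolyTime.ite_eq _ (.anySymb (.zipSymb _ (by fun_prop) (by fun_prop))) (by fun_prop)
        (polyTime_better (by fun_prop) (hf.comp
          (f := fun p : (List Symb × Candidate) × Entry × Candidate => (p.1, p.2.1))
          (by fun_prop)))
    have hsize : ∀ c e x, size (tryEntry (search n) c e x) ≤
        size x + Q.eval (size c + size e) := by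
      intro c e x
      unfold tryEntry Candidate.better
      have h := hQ (c, e)
      split_ifs
      · lia
      · exact h.trans (by simp)
      · lia
    have he : PolyTime fun p : List Symb × Candidate => emptyEntry p.2.1 :=
      .pair (.map _ (by fun_prop)) (by fun_prop)
    exact PolyTime.snd.comp (PolyTime.foldEntries hg Q hsize (by fun_prop)
      (ih.comp (by fun_prop)) (by fun_prop))

end polyTime

/-- Splits a string at its first comma, for the state `(s, x, y)`, where `s` is a comma as soon as
a comma has been read, `x` is the part before it, and `y` is the part behind it. -/
def splitStep (s : Symb) (p : Symb × List Symb × List Symb) : Symb × List Symb × List Symb :=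
  if p.1 = Γ'.comma then (p.1, p.2.1, p.2.2 ++ [s])
  else if s = Γ'.comma then (Γ'.comma, p.2)
  else (p.1, p.2.1 ++ [s], p.2.2)

/-- The parts of a string before and behind its first comma. -/
def splitComma (l : List Symb) : List Symb × List Symb :=
  (l.foldl (fun p s => splitStep s p) (Γ'.blank, [], [])).2

theorem polyTime_splitComma : PolyTime splitComma := by
  refine PolyTime.snd.comp (PolyTime.foldl_of_size_le (f := fun (_ : Symb) s p => splitStep s p)
    (fun s => ?_) 1 (fun c s p => ?_) .id (.const default) (.const _))
  · refine PolyTime.ite_eq _ (by fun_prop) (by fun_prop) ?_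
    by_cases hs : s = Γ'.comma <;> simp only [hs, if_true, if_false] <;> fun_prop
  · unfold splitStep
    split_ifs <;> simp <;> lia

theorem splitComma_eq (m : ℕ) (l : List Symb) :
    splitComma (List.replicate m (Γ'.bit true) ++ Γ'.comma :: l) =
      (List.replicate m (Γ'.bit true), l) := by
  have h₁ : ∀ (m : ℕ) (x : List Symb), (List.replicate m (Γ'.bit true)).foldl
      (fun p s => splitStep s p) (Γ'.blank, x, []) =
        (Γ'.blank, x ++ List.replicate m (Γ'.bit true), []) := by
    intro m
    induction m with
    | zero => simp
    | succ m ih =>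
      intro x
      rw [List.replicate_succ, List.foldl_cons]
      simpa [splitStep] using ih (x ++ [Γ'.bit true])
  have h₂ : ∀ (l x y : List Symb), l.foldl (fun p s => splitStep s p) (Γ'.comma, x, y) =
      (Γ'.comma, x, y ++ l) := by
    intro l
    induction l with
    | nil => simp
    | cons s l ih => intro x y; simpa [splitStep] using ih x (y ++ [s])
  have h₃ : splitStep Γ'.comma (Γ'.blank, List.replicate m (Γ'.bit true), []) =
      (Γ'.comma, List.replicate m (Γ'.bit true), []) := by simp [splitStep]
  rw [splitComma, List.foldl_append, h₁, List.nil_append, List.foldl_cons, h₃, h₂]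
  rfl

/-- The string of an optimal allocation, given the string of a market with `n` agents. -/
def solve (n : ℕ) (l : List Symb) : List Symb :=
  let r := search n ((splitComma l).2, (splitComma l).1.map fun _ => Γ'.bit false, [], [],
    [Γ'.bit true])
  Γ'.bra :: (r.1.map notSymb ++ Γ'.ket :: r.2.1)

theorem polyTime_solve (n : ℕ) : PolyTime (solve n) := by
  have h := polyTime_splitComma
  have hm : PolyTime fun l => (splitComma l).1.map fun _ => Γ'.bit false := .map _ (by fun_prop)
  have hr : PolyTime fun l => search n ((splitComma l).2,
      (splitComma l).1.map (fun _ => Γ'.bit false), [], [], [Γ'.bit true]) :=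
    (polyTime_search n).comp (by fun_prop)
  exact .cons _ (.append (.map _ (by fun_prop)) (by fun_prop))

/-! ### Correctness of the search -/

section correctness

variable {m : ℕ}

/-- The string of a bundle in the string of an allocation. -/
def bundleString (X : Finset (Fin m)) : List Symb := Γ'.bra :: encodeBundle X ++ [Γ'.ket]

/-- The candidate `c` has allocated the items in `U`, in bundles listed by the string `s`, and has
the value `q`. -/
structure Candidate.Represents (c : Candidate) (U : Finset (Fin m)) (s : List Symb) (q : NNRat) :
    Prop where
  used : c.1 = encodeBundle U
  string : c.2.1 = s
  den_pos : 0 < binVal c.2.2.2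
  num : (binVal c.2.2.1 : NNRat) = q * binVal c.2.2.2

/-- The entry `e` is an entry for the bundle `X` with the value `w`. -/
structure Entry.Represents (e : Entry) (X : Finset (Fin m)) (w : NNRat) : Prop where
  bundle : e.1 = encodeBundle X
  den_pos : 0 < binVal e.2.2
  num : (binVal e.2.1 : NNRat) = w * binVal e.2.2

theorem represents_entryOf (v : Finset (Fin m) → NNRat) (X : Finset (Fin m)) :
    (entryOf v X).Represents X (v X) where
  bundle := rfl
  den_pos := by simp [entryOf, binVal_encodeNat]
  num := by simp [entryOf, binVal_encodeNat, NNRat.mul_den_eq_num]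

theorem represents_emptyEntry (U : Finset (Fin m)) :
    (emptyEntry (encodeBundle U)).Represents (∅ : Finset (Fin m)) 0 where
  bundle := map_const_of_length_eq (length_encodeBundle U)
  den_pos := by simp [emptyEntry]
  num := by simp [emptyEntry]

variable {c d : Candidate} {e : Entry} {U V X : Finset (Fin m)} {s t : List Symb} {q r w : NNRat}

theorem Candidate.Represents.addEntry (hc : c.Represents U s q) (he : e.Represents X w) :
    (c.addEntry e).Represents (U ∪ X) (s ++ bundleString X) (q + w) where
  used := by rw [Candidate.addEntry, hc.used, he.bundle, zipSymb_or]
  string := by simp [Candidate.addEntry, hc.string, he.bundle, bundleString]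
  den_pos := by
    simpa [Candidate.addEntry, binVal_mul] using ⟨hc.den_pos, he.den_pos⟩
  num := by
    simp only [Candidate.addEntry, binVal_add, binVal_mul]
    push_cast
    rw [hc.num, he.num]
    ring

theorem Candidate.Represents.better (hc : c.Represents U s q) (hd : d.Represents V t r) :
    c.better d = if q < r then d else c := by
  have hc' : (0 : NNRat) < binVal c.2.2.2 := by exact_mod_cast hc.den_pos
  have hd' : (0 : NNRat) < binVal d.2.2.2 := by exact_mod_cast hd.den_pos
  have h : binVal (mul c.2.2.1 d.2.2.2) < binVal (mul d.2.2.1 c.2.2.2) ↔ q < r := by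
    rw [binVal_mul, binVal_mul, ← Nat.cast_lt (α := NNRat), Nat.cast_mul, Nat.cast_mul, hc.num,
      hd.num, mul_right_comm, mul_right_comm r, mul_assoc, mul_assoc r,
      mul_comm (binVal d.2.2.2 : NNRat)]
    exact mul_lt_mul_iff_left₀ (mul_pos hc' hd')
  simp only [Candidate.better, less_eq, h]
  by_cases hqr : q < r <;> simp [hqr]

/-- The bundles of the list `Ys` are pairwise disjoint, and disjoint from `U`. -/
def Feasible (U : Finset (Fin m)) (Ys : List (Finset (Fin m))) : Prop := (U :: Ys).Pairwise Disjoint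

theorem feasible_cons {Y : Finset (Fin m)} {Ys : List (Finset (Fin m))} :
    Feasible U (Y :: Ys) ↔ Disjoint U Y ∧ Feasible (U ∪ Y) Ys := by
  simp only [Feasible, List.pairwise_cons, List.mem_cons, forall_eq_or_imp,
    Finset.disjoint_union_left]
  constructor
  · rintro ⟨⟨h₁, h₂⟩, h₃, h₄⟩
    exact ⟨h₁, fun a ha => ⟨h₂ a ha, h₃ a ha⟩, h₄⟩
  · rintro ⟨h₁, h₂, h₃⟩
    exact ⟨⟨h₁, fun a ha => (h₂ a ha).1⟩, fun a ha => (h₂ a ha).2, h₃⟩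

/-- The total value of a list of bundles for a list of valuations. -/
def welfare (vs : List (Finset (Fin m) → NNRat)) (Ys : List (Finset (Fin m))) : NNRat :=
  (List.zipWith (fun v Y => v Y) vs Ys).sum

/-- The candidate `x` of value `w` arises from a candidate that has allocated `U`, with string `s`
and value `q`, by one further bundle for each of the valuations `vs`. -/
def Candidate.IsExtension (x : Candidate) (vs : List (Finset (Fin m) → NNRat))
    (U : Finset (Fin m)) (s : List Symb) (q w : NNRat) : Prop :=
  ∃ Ys, Ys.length = vs.length ∧ Feasible U Ys ∧ w = q + welfare vs Ys ∧
    x.Represents (Ys.foldl (· ∪ ·) U) (s ++ Ys.flatMap bundleString) w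

theorem Candidate.IsExtension.cons {x : Candidate} {vs : List (Finset (Fin m) → NNRat)}
    {v : Finset (Fin m) → NNRat} (hd : Disjoint U X)
    (h : x.IsExtension vs (U ∪ X) (s ++ bundleString X) (q + v X) w) :
    x.IsExtension (v :: vs) U s q w := by
  obtain ⟨Ys, hl, hf, hw, hx⟩ := h
  refine ⟨X :: Ys, by simp [hl], feasible_cons.2 ⟨hd, hf⟩, ?_, ?_⟩
  · simp [hw, welfare, add_assoc]
  · simpa using hx

theorem mem_smallBundles {k : ℕ} (hX : X.card ≤ k) : X ∈ smallBundles k m := by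
  have h : (((List.finRange m).filter (· ∈ X)).toFinset) = X := by ext; simp
  simp only [smallBundles, List.mem_map, List.mem_filter, List.mem_sublists]
  refine ⟨(List.finRange m).filter (· ∈ X), ⟨List.filter_sublist, ?_⟩, h⟩
  rw [← List.toFinset_card_of_nodup ((List.nodup_finRange m).filter _), h]
  simpa using hX

theorem dropTable_encodeValuation (k : ℕ) (v : Finset (Fin m) → NNRat) (l : List Symb) :
    dropTable (encodeValuation k v ++ l) = l := by
  obtain ⟨e, he⟩ := exists_foldEntries_eq (fun (_ : Symb) _ x => x) Γ'.blank Γ'.blank (k := k) v l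
  rw [dropTable, he]

/-- The search finds an extension that is optimal among those by bundles of at most `k` items. -/
theorem search_spec (k : ℕ) (vs : List (Finset (Fin m) → NNRat)) (hvs : ∀ v ∈ vs, v ∅ = 0)
    (hc : c.Represents U s q) :
    ∃ w, (search vs.length (vs.flatMap (encodeValuation k), c)).IsExtension vs U s q w ∧
      ∀ Zs, Zs.length = vs.length → Feasible U Zs → (∀ Z ∈ Zs, Z.card ≤ k) →
        q + welfare vs Zs ≤ w := by
  induction vs generalizing c U s q with
  | nil =>
    refine ⟨q, ⟨[], rfl, by simp [Feasible], by simp [welfare], by simpa [search] using hc⟩, ?_⟩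
    intro Zs hZ _ _
    simp [welfare]
  | cons v vs ih =>
    have ih' := fun {c U s q} => ih (fun v hv => hvs v (by simp [hv])) (c := c) (U := U) (s := s)
      (q := q)
    set f := search vs.length with hf
    set l := vs.flatMap (encodeValuation k) with hl
    -- folding over any list of bundles keeps the best of the extensions that begin with them
    have hfold : ∀ (Xs : List (Finset (Fin m))) (x : Candidate) (w : NNRat),
        x.IsExtension (v :: vs) U s q w →
        ∃ w', (Xs.foldl (fun x X => tryEntry f (l, c) (entryOf v X) x) x).IsExtension
            (v :: vs) U s q w' ∧ w ≤ w' ∧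
          ∀ X ∈ Xs, Disjoint U X → ∀ Zs, Zs.length = vs.length → Feasible (U ∪ X) Zs →
            (∀ Z ∈ Zs, Z.card ≤ k) → q + v X + welfare vs Zs ≤ w' := by
      intro Xs
      induction Xs with
      | nil => intro x w hx; exact ⟨w, hx, le_rfl, by simp⟩
      | cons X Xs ihX =>
        intro x w hx
        by_cases hUX : Disjoint U X
        · obtain ⟨wy, hy, hopt⟩ := ih' (hc.addEntry (represents_entryOf v X))
          have hy' := hy.cons hUX
          have hstep : tryEntry f (l, c) (entryOf v X) x =
              if w < wy then f (l, c.addEntry (entryOf v X)) else x := by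
            obtain ⟨_, _, _, _, hx⟩ := hx
            obtain ⟨_, _, _, _, hy⟩ := hy
            rw [tryEntry, hc.used, (represents_entryOf v X).bundle, anySymb_zipSymb_and,
              ← hx.better hy]
            simp [hUX]
          obtain ⟨w', hw', hle, hbest⟩ := ihX (tryEntry f (l, c) (entryOf v X) x) (max w wy) (by
            rw [hstep]
            split_ifs with h
            · rwa [max_eq_right h.le]
            · rwa [max_eq_left (not_lt.1 h)])
          refine ⟨w', hw', (le_max_left _ _).trans hle, fun X' hX' => ?_⟩
          rcases List.mem_cons.1 hX' with rfl | hX'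
          · intro _ Zs hZ hZf hZk
            exact (hopt Zs hZ hZf hZk).trans ((le_max_right _ _).trans hle)
          · exact hbest X' hX'
        · have hstep : tryEntry f (l, c) (entryOf v X) x = x := by
            rw [tryEntry, hc.used, (represents_entryOf v X).bundle, anySymb_zipSymb_and]
            simp [hUX]
          obtain ⟨w', hw', hle, hbest⟩ := ihX x w hx
          rw [List.foldl_cons, hstep]
          refine ⟨w', hw', hle, fun X' hX' => ?_⟩
          rcases List.mem_cons.1 hX' with rfl | hX'
          · exact fun h => absurd h hUX
          · exact hbest X' hX'
    -- the initial value of the loop, which starts with the empty bundle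
    obtain ⟨w₀, h₀, -⟩ := ih' (hc.addEntry (hc.used ▸ represents_emptyEntry U))
    rw [← hvs v (by simp)] at h₀
    obtain ⟨w, hw, -, hbest⟩ := hfold (smallBundles k m) _ w₀
      (h₀.cons (Finset.disjoint_empty_right U))
    refine ⟨w, ?_, ?_⟩
    · rw [List.length_cons, search, List.flatMap_cons, dropTable_encodeValuation]
      obtain ⟨e, he⟩ := exists_foldEntries_eq (tryEntry f) (l, c)
        (f (l, c.addEntry (emptyEntry c.1))) (k := k) v l
      rw [he]
      exact hw
    · intro Zs hZ hZf hZk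
      obtain _ | ⟨X, Zs⟩ := Zs
      · simp at hZ
      obtain ⟨hd, hZf⟩ := feasible_cons.1 hZf
      have := hbest X (mem_smallBundles (hZk X (by simp))) hd Zs (by simpa using hZ) hZf
        fun Z hZ => hZk Z (by simp [hZ])
      simpa [welfare, add_assoc] using this

end correctness

theorem mem_foldl_union {m : ℕ} (Ys : List (Finset (Fin m))) (U : Finset (Fin m)) (a : Fin m) :
    a ∈ Ys.foldl (· ∪ ·) U ↔ a ∈ U ∨ ∃ Y ∈ Ys, a ∈ Y := by
  induction Ys generalizing U with
  | nil => simp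
  | cons Y Ys ih => simp [ih, or_assoc]

theorem feasible_empty_map {m n : ℕ} {Y : Fin n → Finset (Fin m)} :
    Feasible ∅ ((List.finRange n).map Y) ↔ ∀ i j, i ≠ j → Disjoint (Y i) (Y j) := by
  have h : Feasible ∅ ((List.finRange n).map Y) ↔
      (List.finRange n).Pairwise fun i j => Disjoint (Y i) (Y j) := by
    simp [Feasible, List.pairwise_map]
  rw [h]
  constructor
  · intro h i j hij
    have : Std.Symm fun i j => Disjoint (Y i) (Y j) := ⟨fun _ _ h => Disjoint.symm h⟩
    exact h.forall (by simp) (by simp) hij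
  · exact fun h => (List.nodup_finRange n).imp fun hij => h _ _ hij

theorem welfare_map {m n : ℕ} (v : Fin n → Finset (Fin m) → NNRat) (Y : Fin n → Finset (Fin m)) :
    welfare ((List.finRange n).map v) ((List.finRange n).map Y) = ∑ i, v i (Y i) := by
  rw [welfare, List.zipWith_map, List.zipWith_self, Fin.sum_univ_def]

theorem winnerDetermination_solve {k n : ℕ} (M : KDemandMarket k n) :
    WinnerDetermination M (solve n (encodeMarket M)) := by
  obtain ⟨M, hM⟩ := M
  have hc : Candidate.Represents (m := M.numItems) ((List.replicate M.numItems (Γ'.bit true)).map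
      (fun _ => Γ'.bit false), [], [], [Γ'.bit true]) ∅ [] 0 :=
    ⟨map_const_of_length_eq (by simp), rfl, by simp, by simp⟩
  obtain ⟨w, ⟨Ys, hl, hf, hw, hx⟩, hopt⟩ := search_spec k ((List.finRange n).map M.val)
    (by simpa using M.normalized) hc
  have hlen : ((List.finRange n).map M.val).length = n := by simp
  rw [hlen, List.flatMap_map] at hx
  obtain ⟨Y, rfl⟩ : ∃ Y : Fin n → Finset (Fin M.numItems), Ys = (List.finRange n).map Y := by
    rw [hlen] at hl
    exact ⟨fun i => Ys.get (i.cast hl.symm), List.ext_getElem (by simp [hl]) (by simp)⟩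
  rw [feasible_empty_map] at hf
  set V := ((List.finRange n).map Y).foldl (· ∪ ·) ∅ with hV
  have hmem : ∀ a, a ∈ V ↔ ∃ i, a ∈ Y i := fun a => by simp [hV, mem_foldl_union]
  have hdisj : ∀ i, Disjoint Vᶜ (Y i) := fun i =>
    Finset.disjoint_left.2 fun a ha hi => Finset.mem_compl.1 ha ((hmem a).2 ⟨i, hi⟩)
  let S : Allocation n M.numItems :=
    { bundle := Fin.cons Vᶜ Y
      disjoint := by
        intro i j
        refine Fin.cases ?_ (fun i => ?_) i <;> refine Fin.cases ?_ (fun j => ?_) j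
        · simp
        · intro _; simpa using hdisj j
        · intro _; simpa using (hdisj i).symm
        · intro hij; simpa using hf i j fun h => hij (h ▸ rfl)
      covers := by
        intro a
        by_cases ha : a ∈ V
        · obtain ⟨i, hi⟩ := (hmem a).1 ha
          exact ⟨i.succ, by simpa using hi⟩
        · exact ⟨0, by simpa using ha⟩ }
  have hopt' : M.IsOptimal S := by
    intro T
    -- by the demand bound, the bundles of `T` can be replaced by small ones of the same value
    choose Z hZ hZv using fun i => (hM i (T.bundle i.succ)).1
    have h := hopt ((List.finRange n).map Z) (by simp) (feasible_empty_map.2 fun i j hij =>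
      Finset.disjoint_of_subset_left (hZ i).1 (Finset.disjoint_of_subset_right (hZ j).1
        (T.disjoint _ _ fun h => hij (Fin.succ_injective _ h)))) (by simpa using fun i => (hZ i).2)
    rw [hw, zero_add, zero_add, welfare_map, welfare_map] at h
    simpa [Market.socialWelfare, S, hZv] using h
  have hs : solve n (encodeMarket ⟨M, hM⟩) = encodeAllocation S := by
    have he : encodeMarket ⟨M, hM⟩ = List.replicate M.numItems (Γ'.bit true) ++ Γ'.comma ::
      (List.finRange n).flatMap fun i => encodeValuation k (M.val i) := rfl
    rw [solve, he, splitComma_eq]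
    simp only [hx.used, hx.string, map_notSymb_encodeBundle]
    simp [encodeAllocation, List.finRange_succ, List.flatMap_map, S, bundleString]
  exact ⟨S, hopt', hs⟩

/-! ### The length of the input -/

theorem length_smallBundles_le (k m : ℕ) : (smallBundles k m).length ≤ (m + 1) ^ k := by
  have h : ∀ (l : List (Fin m)) (k : ℕ),
      l.sublists'.countP (fun l => decide (l.length ≤ k)) ≤ (l.length + 1) ^ k := by
    intro l
    induction l with
    | nil => intro k; simp
    | cons a l ih =>
      intro k
      rw [List.sublists'_cons, List.countP_append, List.countP_map]
      obtain _ | k := k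
      · have := ih 0
        simpa [Function.comp_def] using this
      · have h₁ := ih (k + 1)
        have h₂ := ih k
        have h₃ : (l.length + 1) ^ k ≤ (l.length + 2) ^ k := Nat.pow_le_pow_left (by lia) k
        simp only [Function.comp_def, List.length_cons, Nat.add_le_add_iff_right]
        have h₄ := Nat.mul_le_mul_right (l.length + 2) h₃
        rw [pow_succ] at h₁ ⊢
        change _ ≤ (l.length + 2) ^ k * (l.length + 2)
        generalize (l.length + 1) ^ k = p at *
        linarith
  rw [smallBundles, List.length_map, ← List.countP_eq_length_filter,
    (List.sublists_perm_sublists' _).countP_eq]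
  simpa using h (List.finRange m) k

theorem length_encodeMarket_le {k n : ℕ} (M : KDemandMarket k n) :
    (encodeMarket M).length ≤
      (5 * n + 1) * (M.1.numItems + 1) ^ (k + 1) * (M.1.valueSize + 1) := by
  obtain ⟨M, hM⟩ := M
  set m := M.numItems
  set b := M.valueSize with hb
  set P := (m + 1) ^ k with hP
  have hval : ∀ i X, (encodeValue (M.val i X)).length ≤ b := fun i X =>
    Finset.le_sup (f := fun p : Fin n × Finset (Fin M.numItems) =>
      (encodeValue (M.val p.1 p.2)).length) (Finset.mem_univ (i, X))
  have htable : ∀ i, (encodeValuation k (M.val i)).length ≤ 2 + P * (m + b + 3) := by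
    intro i
    have h : ((smallBundles k m).map fun X => (Γ'.bra :: encodeBundle X ++ Γ'.comma ::
        encodeValue (M.val i X) ++ [Γ'.ket]).length).sum ≤
        (smallBundles k m).length * (m + b + 3) := by
      refine (List.sum_le_card_nsmul _ (m + b + 3) ?_).trans (by simp)
      simp only [List.mem_map]
      rintro _ ⟨X, -, rfl⟩
      have := hval i X
      simp
      lia
    have h' := Nat.mul_le_mul_right (m + b + 3) (length_smallBundles_le k m)
    simp only [encodeValuation, List.length_append, List.length_cons, List.length_flatMap,
      List.length_nil] at h ⊢
    lia
  have hall : ((List.finRange n).map fun i => (encodeValuation k (M.val i)).length).sum ≤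
      n * (2 + P * (m + b + 3)) := by
    refine (List.sum_le_card_nsmul _ (2 + P * (m + b + 3)) ?_).trans (by simp)
    simp only [List.mem_map]
    rintro _ ⟨i, -, rfl⟩
    exact htable i
  have hlen : (encodeMarket ⟨M, hM⟩).length ≤ m + 1 + n * (2 + P * (m + b + 3)) := by
    simp only [encodeMarket, List.length_append, List.length_cons, List.length_flatMap,
      List.length_replicate]
    lia
  have hP1 : 1 ≤ P := Nat.one_le_pow _ _ (by lia)
  have h₁ : m + 1 ≤ P * (m + 1) * (b + 1) := by nlinarith [Nat.zero_le (P * (m + 1) * b)]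
  have h₂ : 2 + P * (m + b + 3) ≤ 5 * (P * (m + 1) * (b + 1)) := by
    nlinarith [Nat.zero_le (P * m * b), Nat.zero_le (P * m), Nat.zero_le (P * b)]
  calc _ ≤ P * (m + 1) * (b + 1) + n * (5 * (P * (m + 1) * (b + 1))) :=
        hlen.trans (Nat.add_le_add h₁ (Nat.mul_le_mul_left n h₂))
    _ = _ := by rw [pow_succ]; ring

end KDemand

theorem mainTheorem5 (k n : ℕ) :
    KDemand.SolvableInPolyTime
        (KDemand.encodeMarket : KDemand.KDemandMarket k n → List KDemand.Symb)
        KDemand.WinnerDetermination ∧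
      ∃ c : ℕ, ∀ M : KDemand.KDemandMarket k n,
        (KDemand.encodeMarket M).length ≤
          c * (M.1.numItems + 1) ^ (k + 1) * (M.1.valueSize + 1) :=
  ⟨⟨_, (KDemand.polyTime_solve n).tm2ComputableInPolyTime KDemand.encodeMarket,
    KDemand.winnerDetermination_solve⟩, 5 * n + 1, KDemand.length_encodeMarket_le⟩
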